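/- Let $H\in(1/2,1)$, $\alpha\in(1-H,1/2)$, $\beta\in(1/2,H)$, and let $B=\{B_t,t\ge 0\}$ be a fractional Brownian motion with Hurst parameter $H$ and continuous paths on a probability space $(\Omega,\mathcal F,\mathsf P)$, i.e. a centered Gaussian process with $\mathsf E[B_tB_s]=\frac12(s^{2H}+t^{2H}-|t-s|^{2H})$. For functions $f,g$ and $c<d$ put $$(D_{c+}^{\alpha}f)(x)=\frac{1}{\Gamma(1-\alpha)}\Big(\frac{f(x)}{(x-c)^\alpha}+\alpha\int_c^x\frac{f(x)-f(u)}{(x-u)^{1+\alpha}}du\Big),$$ $$(D_{d-}^{1-\alpha}g)(x)=\frac{e^{i\pi(1-\alpha)}}{\Gamma(\alpha)}\Big(\frac{g(x)}{(d-x)^{1-\alpha}}+(1-\alpha)\int_x^d\frac{g(x)-g(u)}{(u-x)^{2-\alpha}}du\Big),$$ $g_{d-}=g-g(d)$, and $$\int_c^d f\,dg=e^{i\pi\alpha}\int_c^d(D_{c+}^{\alpha}f)(x)\,(D_{d-}^{1-\alpha}g_{d-})(x)\,dx .$$ Write $Z(u,v)=(D^{1-\alpha}_{v-}B_{v-})(u)$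 for $0\le u<v$, and $$\Lambda_\beta(t_1,t_2)=1\vee\sup_{t_1\le u<v\le t_2}\frac{|Z(u,v)|}{(v-u)^{\beta+\alpha-1}}\in[1,\infty].$$ Let $a,b:\mathbb R\to\mathbb R$, with $b$ differentiable, be such that for some $\delta\in(1/H-1,1]$, $K>0$, $L>0$: $|a(x)|+|b(x)|\le K$ and $|a(x)-a(y)|+|b(x)-b(y)|\le L|x-y|$ for all $x,y\in\mathbb R$, and for every $N\ge1$ there is $R_N>0$ with $|b'(x)-b'(y)|\le R_N|x-y|^\delta$ for all $x,y\in[-N,N]$. Let $X_0\in\mathbb R$ be non-random and let $X=\{X_t,t\ge0\}$ be a process with continuous paths that solves $$X_t=X_0+\int_0^t a(X_s)\,ds+\int_0^t b(X_s)\,dB_s,\qquad t\ge 0,$$ where being a solution includes that, almost surely, $D_{0+}^{\alpha}b(X)$ is well defined and in $L_1[0,t]$ for every $t\ge 0$, in the sense that $s\mapsto b(X_s)s^{-\alpha}$ is integrable on $(0,t)$ and $(s,u)\mapsto (b(X_s)-b(X_u))(s-u)^{-1-\alpha}$ is integrable on $\{0<u<s<t\}$. Then for every $\gamma>1/2$,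 with $\kappa=\gamma/\beta$, there exist random variables $\xi$ and $\zeta$ such that almost surely, for all $t_1\ge0$ and $t_2\in(t_1,t_1+1]$, $$|X_{t_2}-X_{t_1}|\le\zeta\,(t_2-t_1)^\beta\,(\log(t_2+2))^\kappa,\qquad \Lambda_\beta(t_1,t_2)\le\xi\,(\log(t_2+2))^{\kappa\beta}.$$ Moreover, there exists $c>0$ such that $\mathsf E\exp\{x\xi^2\}<\infty$ and $\mathsf E\exp\{x\zeta^{2\beta}\}<\infty$ for all $x<c$. In particular, all moments of $\xi$ and $\zeta$ are finite. -/

import Mathlib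

open MeasureTheory ProbabilityTheory
open scoped NNReal ENNReal

namespace FracSDE

/-- The path `t ↦ Y_t(ω)` of a process indexed by `[0, ∞)`, as a function on `ℝ`
(constant, equal to `Y_0(ω)`, on the negative half-line, which is never used). -/
def path {Ω : Type*} (Y : ℝ≥0 → Ω → ℝ) (ω : Ω) (t : ℝ) : ℝ := Y t.toNNReal ω

/-- Fractional Brownian motion with Hurst parameter `H`: a centered Gaussian process on `[0, ∞)`
with covariance `(s^{2H} + t^{2H} - |t - s|^{2H}) / 2` and (almost surely) continuous paths. -/
structure IsFBM {Ω : Type*} [MeasurableSpace Ω] (P : Measure Ω) (H : ℝ)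
    (B : ℝ≥0 → Ω → ℝ) : Prop where
  gaussian : IsGaussianProcess B P
  centered : ∀ t, ∫ ω, B t ω ∂P = 0
  covariance : ∀ s t : ℝ≥0, ∫ ω, B t ω * B s ω ∂P =
    ((s : ℝ) ^ (2 * H) + (t : ℝ) ^ (2 * H) - |(t : ℝ) - (s : ℝ)| ^ (2 * H)) / 2
  continuous_paths : ∀ᵐ ω ∂P, Continuous fun t => B t ω

/-- The left-sided fractional derivative `(D_{a+}^α f)(x)`. -/
noncomputable def leftFracDeriv (α a : ℝ) (f : ℝ → ℝ) (x : ℝ) : ℝ :=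
  1 / Real.Gamma (1 - α) *
    (f x / (x - a) ^ α + α * ∫ u in a..x, (f x - f u) / (x - u) ^ (1 + α))

/-- The right-sided fractional derivative `(D_{b-}^{1-α} g)(x)`, with the standard phase
`(-1)^{1-α} = e^{iπ(1-α)}`. -/
noncomputable def rightFracDeriv (α b : ℝ) (g : ℝ → ℝ) (x : ℝ) : ℂ :=
  Complex.exp (Complex.I * (Real.pi * (1 - α) : ℝ)) / (Real.Gamma α : ℂ) *
    ((g x / (b - x) ^ (1 - α) +
      (1 - α) * ∫ u in x..b, (g x - g u) / (u - x) ^ (2 - α) : ℝ) : ℂ)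

/-- `D_{a+}^α f` is well defined and belongs to `L_1[a, b]`: both terms of the fractional
derivative are absolutely integrable over `[a, b]`. -/
def LeftFracIntegrable (α a b : ℝ) (f : ℝ → ℝ) : Prop :=
  IntegrableOn (fun x => f x / (x - a) ^ α) (Set.Ioo a b) ∧
  IntegrableOn (fun p : ℝ × ℝ => (f p.1 - f p.2) / (p.1 - p.2) ^ (1 + α))
    {p : ℝ × ℝ | a < p.2 ∧ p.2 < p.1 ∧ p.1 < b}

/-- The generalized Lebesgue-Stieltjes integral
`∫_a^b f dg = e^{iπα} ∫_a^b (D_{a+}^α f)(x) (D_{b-}^{1-α} g_{b-})(x) dx`, `g_{b-} = g - g(b)`. -/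
noncomputable def glsIntegral (α a b : ℝ) (f g : ℝ → ℝ) : ℂ :=
  Complex.exp (Complex.I * (Real.pi * α : ℝ)) *
    ∫ x in a..b, (leftFracDeriv α a f x : ℂ) * rightFracDeriv α b (fun y => g y - g b) x

/-- `Z(t₁, t₂) = (D_{t₂-}^{1-α} g_{t₂-})(t₁)` for a path `g`. -/
noncomputable def Z (α : ℝ) (g : ℝ → ℝ) (t₁ t₂ : ℝ) : ℂ :=
  rightFracDeriv α t₂ (fun y => g y - g t₂) t₁

/-- `Λ_β(t₁, t₂) = 1 ∨ sup_{t₁ ≤ u < v ≤ t₂} |Z(u, v)| / (v - u)^{β+α-1}`, for a path `g`,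
with values in `[0, ∞]`. -/
noncomputable def Lambda (α β : ℝ) (g : ℝ → ℝ) (t₁ t₂ : ℝ) : ℝ≥0∞ :=
  max 1 (⨆ (u : ℝ) (v : ℝ) (_ : t₁ ≤ u ∧ u < v ∧ v ≤ t₂),
    ENNReal.ofReal (‖Z α g u v‖ / (v - u) ^ (β + α - 1)))

/-- The assumptions on the coefficients: boundedness, Lipschitz continuity, and local
`δ`-Hölder continuity of `b'`, for some `δ ∈ (1/H - 1, 1]`. -/
def CoeffAssumptions (H : ℝ) (a b : ℝ → ℝ) : Prop :=
  ∃ δ K L : ℝ, 1 / H - 1 < δ ∧ δ ≤ 1 ∧ 0 < K ∧ 0 < L ∧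
    (∀ x, |a x| + |b x| ≤ K) ∧
    (∀ x y, |a x - a y| + |b x - b y| ≤ L * |x - y|) ∧
    Differentiable ℝ b ∧
    (∀ N : ℝ, 1 ≤ N → ∃ R : ℝ, 0 < R ∧ ∀ x ∈ Set.Icc (-N) N, ∀ y ∈ Set.Icc (-N) N,
      |deriv b x - deriv b y| ≤ R * |x - y| ^ δ)

/-- `X` is a solution of `X_t = x₀ + ∫_0^t a(X_s) ds + ∫_0^t b(X_s) dB_s`, `t ≥ 0`: a process with
(almost surely) continuous paths such that almost surely, for all `t ≥ 0`, the integral with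
respect to `B` makes sense and the equation holds. -/
structure IsSolution {Ω : Type*} [MeasurableSpace Ω] (P : Measure Ω) (α : ℝ)
    (a b : ℝ → ℝ) (x₀ : ℝ) (B X : ℝ≥0 → Ω → ℝ) : Prop where
  aemeasurable : ∀ t, AEMeasurable (X t) P
  continuous_paths : ∀ᵐ ω ∂P, Continuous fun t => X t ω
  integrable : ∀ᵐ ω ∂P, ∀ t : ℝ, 0 ≤ t →
    LeftFracIntegrable α 0 t (fun s => b (path X ω s))
  equation : ∀ᵐ ω ∂P, ∀ t : ℝ, 0 ≤ t →
    (path X ω t : ℂ) = (x₀ : ℂ) + ((∫ s in (0 : ℝ)..t, a (path X ω s) : ℝ) : ℂ) +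
      glsIntegral α 0 t (fun s => b (path X ω s)) (path B ω)

end FracSDE

namespace FracSDE

open Set Filter Topology

/-! The argument is pathwise, followed by a Gaussian tail estimate. Fix `β'` strictly between `max β
(1 - α)` and `H`, so that paths of `B` are locally `β'`-Hölder and `α + β' > 1`. If `M` is the
Hölder constant of `B` near `[t₁, t₂]`, then `Λ_β` is bounded by a multiple of `max 1 M`, while the
increment of `X` is at most `C (1 + M)^(1/β') (t₂ - t₁)^β'`. It remains to see that `M` is at most a
Gaussian-tailed variable times a power of `log (t₂ + 2)`.

The difficulty in the bound for `X` is that no Hölder regularity of `X` is assumed, only finiteness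
of the Gagliardo seminorm of `b(X)`. For a smooth integrator the fractional integral is a constant
multiple of `∫ f g'` (`realGls_of_hasDerivAt`); approximating by Steklov averages gives additivity
in the interval (`realGls_add`) and a Young-Loeve estimate through sewing
(`abs_realGls_le_of_increments`), whose control may contain the Gagliardo seminorm, since that
seminorm is superadditive. Feeding in the crude bound `abs_realGls_le` shows that `X` is Hölder with
some finite constant. On an interval with `M (T - S)^β'` small, the same estimate halves the
dependence on that constant, so iteration replaces it by a multiple of `1 + M`. Cutting a unit
interval into about `M^(1/β')` such pieces gives the power `1/β'` (`exists_controlledPath_bound`).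

For `B`, a weighted sum over dyadic increments of `exp (c N²)`, with `N` standard Gaussian, has
finite mean (`IsFBM.exists_dyadic_bound`). Its logarithm dominates all dyadic increments at once,
and chaining turns this into a Hölder bound growing like the square root of a logarithm
(`IsFBM.exists_holder_bound`). -/

/-! ### Real-valued cores of the fractional derivatives -/

/-- `g` is Hölder continuous on `[A, B]` with exponent `β` and constant `M`. -/
def HolderBound (M β A B : ℝ) (g : ℝ → ℝ) : Prop :=
  ∀ x y, A ≤ x → x ≤ y → y ≤ B → |g y - g x| ≤ M * (y - x) ^ β

/-- The right-sided derivative of `g - g b`, without phase and Gamma factor. -/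
noncomputable def rightCore (α b : ℝ) (g : ℝ → ℝ) (x : ℝ) : ℝ :=
  (g x - g b) / (b - x) ^ (1 - α) + (1 - α) * ∫ u in x..b, (g x - g u) / (u - x) ^ (2 - α)

/-- The left-sided derivative of `f`, without Gamma factor. -/
noncomputable def leftCore (α a : ℝ) (f : ℝ → ℝ) (x : ℝ) : ℝ :=
  f x / (x - a) ^ α + α * ∫ u in a..x, (f x - f u) / (x - u) ^ (1 + α)

/-- The generalized Lebesgue-Stieltjes integral up to a multiplicative constant. -/
noncomputable def realGls (α a b : ℝ) (f g : ℝ → ℝ) : ℝ :=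
  ∫ x in a..b, leftCore α a f x * rightCore α b g x

/-- The set of pairs `(x, u)` with `a < u < x < b`. -/
def triangle (a b : ℝ) : Set (ℝ × ℝ) := {p | a < p.2 ∧ p.2 < p.1 ∧ p.1 < b}

/-- The Gagliardo-type seminorm of `f` on `[a, b]`. -/
noncomputable def gagliardo (α : ℝ) (f : ℝ → ℝ) (a b : ℝ) : ℝ :=
  ∫ p in triangle a b, |(f p.1 - f p.2) / (p.1 - p.2) ^ (1 + α)|

lemma rightFracDeriv_eq (α b : ℝ) (g : ℝ → ℝ) (x : ℝ) :
    rightFracDeriv α b (fun y => g y - g b) x =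
      Complex.exp (Complex.I * (Real.pi * (1 - α) : ℝ)) / (Real.Gamma α : ℂ) *
        (rightCore α b g x : ℂ) := by
  simp only [rightFracDeriv, rightCore, sub_sub_sub_cancel_right]

lemma norm_Z {α : ℝ} (hα : 0 < α) (g : ℝ → ℝ) (u v : ℝ) :
    ‖Z α g u v‖ = |rightCore α v g u| / Real.Gamma α := by
  rw [Z, rightFracDeriv_eq, norm_mul, norm_div, mul_comm Complex.I, Complex.norm_exp_ofReal_mul_I,
    Complex.norm_real, Complex.norm_real, Real.norm_of_nonneg (Real.Gamma_pos_of_pos hα).le,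
    Real.norm_eq_abs]
  ring

/-- The phases `e^{iπα}` and `e^{iπ(1-α)}` multiply to `-1`, so the complex integral is real and
everything below can be done over `ℝ`. -/
lemma glsIntegral_eq (α a b : ℝ) (f g : ℝ → ℝ) :
    glsIntegral α a b f g =
      ((-(1 / (Real.Gamma α * Real.Gamma (1 - α))) * realGls α a b f g : ℝ) : ℂ) := by
  have h : ∀ x, (leftFracDeriv α a f x : ℂ) * rightFracDeriv α b (fun y => g y - g b) x =
      (Complex.exp (Complex.I * (Real.pi * (1 - α) : ℝ)) / (Real.Gamma α : ℂ) *
        (1 / Real.Gamma (1 - α) : ℝ)) * ((leftCore α a f x * rightCore α b g x : ℝ) : ℂ) := by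
    intro x
    rw [rightFracDeriv_eq, leftFracDeriv, ← leftCore]
    push_cast
    ring
  have hexp : Complex.exp (Complex.I * (Real.pi * α : ℝ)) *
      Complex.exp (Complex.I * (Real.pi * (1 - α) : ℝ)) = -1 := by
    rw [← Complex.exp_add, ← Complex.exp_pi_mul_I]
    congr 1
    push_cast
    ring
  rw [glsIntegral]
  simp_rw [h]
  rw [intervalIntegral.integral_const_mul, intervalIntegral.integral_ofReal, ← realGls]
  rw [show ∀ A B C D E : ℂ, A * (B / C * D * E) = A * B * (1 / C * D * E) by intros; ring, hexp]
  push_cast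
  ring

/-! ### Power kernels and the right derivative of a Hölder function -/

lemma integral_sub_left_rpow {p : ℝ} (hp : -1 < p) (x b : ℝ) :
    ∫ u in x..b, (u - x) ^ p = (b - x) ^ (p + 1) / (p + 1) := by
  rw [intervalIntegral.integral_comp_sub_right (fun u => u ^ p), sub_self,
    integral_rpow (Or.inl hp), Real.zero_rpow (by linarith), sub_zero]

lemma intervalIntegrable_sub_left_rpow {p : ℝ} (hp : -1 < p) (c x b : ℝ) :
    IntervalIntegrable (fun u => (u - c) ^ p) volume x b := by
  have := (intervalIntegral.intervalIntegrable_rpow' (a := x - c) (b := b - c) hp).comp_sub_right c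
  simpa using this

lemma intervalIntegrable_sub_right_rpow {p : ℝ} (hp : -1 < p) (c a x : ℝ) :
    IntervalIntegrable (fun u => (c - u) ^ p) volume a x := by
  have := (intervalIntegral.intervalIntegrable_rpow' (a := c - a) (b := c - x) hp).comp_sub_left c
  simpa using this

lemma abs_div_rpow_le {M β γ r y : ℝ} (hr : 0 < r) (hy : |y| ≤ M * r ^ β) :
    |y / r ^ γ| ≤ M * r ^ (β - γ) := by
  rw [abs_div, abs_of_pos (Real.rpow_pos_of_pos hr γ), div_le_iff₀ (Real.rpow_pos_of_pos hr γ),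
    mul_assoc, ← Real.rpow_add hr, sub_add_cancel]
  exact hy

lemma HolderBound.mono {M β A B A' B' : ℝ} {g : ℝ → ℝ} (h : HolderBound M β A B g)
    (hA : A ≤ A') (hB : B' ≤ B) : HolderBound M β A' B' g :=
  fun x y hx hxy hy => h x y (hA.trans hx) hxy (hy.trans hB)

lemma HolderBound.abs_rightCore_le {α β M b x : ℝ} {g : ℝ → ℝ} (hα1 : α < 1)
    (hαβ : 1 < α + β) (hxb : x ≤ b) (hg : HolderBound M β x b g) :
    |rightCore α b g x| ≤ M * (1 + (1 - α) / (α + β - 1)) * (b - x) ^ (α + β - 1) := by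
  rcases hxb.eq_or_lt with rfl | hxb
  · simp [rightCore, Real.zero_rpow (sub_pos.2 hαβ).ne']
  have h1 : |(g x - g b) / (b - x) ^ (1 - α)| ≤ M * (b - x) ^ (α + β - 1) := by
    have := abs_div_rpow_le (γ := 1 - α) (sub_pos.2 hxb)
      (by rw [abs_sub_comm]; exact hg x b le_rfl hxb.le le_rfl : |g x - g b| ≤ M * (b - x) ^ β)
    rwa [show β - (1 - α) = α + β - 1 by ring] at this
  have h2 : |∫ u in x..b, (g x - g u) / (u - x) ^ (2 - α)| ≤
      M * ((b - x) ^ (α + β - 1) / (α + β - 1)) := by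
    have h3 : ∫ u in x..b, M * (u - x) ^ (α + β - 2) =
        M * ((b - x) ^ (α + β - 1) / (α + β - 1)) := by
      rw [intervalIntegral.integral_const_mul, integral_sub_left_rpow (by linarith),
        show α + β - 2 + 1 = α + β - 1 by ring]
    rw [← h3, ← Real.norm_eq_abs]
    refine intervalIntegral.norm_integral_le_of_norm_le hxb.le (Eventually.of_forall ?_)
      ((intervalIntegrable_sub_left_rpow (by linarith) x x b).const_mul M)
    intro u hu
    have := abs_div_rpow_le (γ := 2 - α) (sub_pos.2 hu.1)
      (by rw [abs_sub_comm]; exact hg x u le_rfl hu.1.le hu.2 : |g x - g u| ≤ M * (u - x) ^ β)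
    rwa [show β - (2 - α) = α + β - 2 by ring] at this
  calc |rightCore α b g x| ≤ |(g x - g b) / (b - x) ^ (1 - α)| +
        |(1 - α) * ∫ u in x..b, (g x - g u) / (u - x) ^ (2 - α)| := abs_add_le _ _
    _ ≤ M * (b - x) ^ (α + β - 1) +
        (1 - α) * (M * ((b - x) ^ (α + β - 1) / (α + β - 1))) := by
        rw [abs_mul, abs_of_pos (sub_pos.2 hα1)]
        have : 0 ≤ 1 - α := by linarith
        gcongr
    _ = _ := by ring

/-- The common Hölder constant dominates the integrands by `M (u - x)^(α+β-2)`, integrable because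
`α + β > 1`. -/
lemma tendsto_rightCore {α β M b x : ℝ} {g : ℝ → ℝ} {gn : ℕ → ℝ → ℝ}
    (hαβ : 1 < α + β) (hxb : x < b) (hgn : ∀ n, HolderBound M β x b (gn n))
    (hc : ∀ n, Continuous (gn n))
    (hlim : ∀ y, Tendsto (fun n => gn n y) atTop (𝓝 (g y))) :
    Tendsto (fun n => rightCore α b (gn n) x) atTop (𝓝 (rightCore α b g x)) := by
  refine Tendsto.add (((hlim x).sub (hlim b)).div_const _) (Tendsto.const_mul _ ?_)
  refine intervalIntegral.tendsto_integral_filter_of_dominated_convergence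
    (fun u => M * (u - x) ^ (α + β - 2)) (Eventually.of_forall fun n => ?_)
    (Eventually.of_forall fun n => Eventually.of_forall fun u hu => ?_)
    ((intervalIntegrable_sub_left_rpow (by linarith) x x b).const_mul M)
    (Eventually.of_forall fun u _ => ((hlim x).sub (hlim u)).div_const _)
  · refine Measurable.aestronglyMeasurable ?_
    have := (hc n).measurable
    fun_prop
  · rw [uIoc_of_le hxb.le] at hu
    have := abs_div_rpow_le (γ := 2 - α) (sub_pos.2 hu.1)
      (by rw [abs_sub_comm]; exact hgn n x u le_rfl hu.1.le hu.2 :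
        |gn n x - gn n u| ≤ M * (u - x) ^ β)
    rwa [show β - (2 - α) = α + β - 2 by ring] at this

/-! ### Fubini on the triangle and the Gagliardo seminorm -/

lemma measurableSet_triangle (a b : ℝ) : MeasurableSet (triangle a b) := by
  refine MeasurableSet.inter ?_ (MeasurableSet.inter ?_ ?_)
  · exact measurableSet_lt measurable_const measurable_snd
  · exact measurableSet_lt measurable_snd measurable_fst
  · exact measurableSet_lt measurable_fst measurable_const

lemma aestronglyMeasurable_rightCore {α a b : ℝ} {g : ℝ → ℝ} (hg : Continuous g) :
    AEStronglyMeasurable (rightCore α b g) (volume.restrict (Ioc a b)) := by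
  have hgm := hg.measurable
  have h1 : StronglyMeasurable (fun x => ∫ u, Set.indicator {p : ℝ × ℝ | p.1 < p.2 ∧ p.2 ≤ b}
      (fun p => (g p.1 - g p.2) / (p.2 - p.1) ^ (2 - α)) (x, u)) := by
    refine StronglyMeasurable.integral_prod_right ?_
    refine Measurable.stronglyMeasurable (Measurable.indicator (by fun_prop) ?_)
    exact (measurableSet_lt measurable_fst measurable_snd).inter
      (measurableSet_le measurable_snd measurable_const)
  have h2 : AEStronglyMeasurable (fun x => (g x - g b) / (b - x) ^ (1 - α) + (1 - α) *
      ∫ u, Set.indicator {p : ℝ × ℝ | p.1 < p.2 ∧ p.2 ≤ b}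
      (fun p => (g p.1 - g p.2) / (p.2 - p.1) ^ (2 - α)) (x, u)) (volume.restrict (Ioc a b)) := by
    refine AEStronglyMeasurable.add (Measurable.aestronglyMeasurable (by fun_prop)) ?_
    exact (h1.aestronglyMeasurable).const_mul _
  refine h2.congr ?_
  filter_upwards [ae_restrict_mem measurableSet_Ioc] with x hx
  rw [rightCore, intervalIntegral.integral_of_le hx.2, ← integral_indicator measurableSet_Ioc]
  rfl

lemma triangle_mono {a b a' b' : ℝ} (ha : a ≤ a') (hb : b' ≤ b) :
    triangle a' b' ⊆ triangle a b :=
  fun _ hp => ⟨ha.trans_lt hp.1, hp.2.1, hp.2.2.trans_le hb⟩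

lemma integral_indicator_triangle_left {a b x : ℝ} (F : ℝ × ℝ → ℝ) (hx : x ∈ Ioo a b) :
    ∫ u, (triangle a b).indicator F (x, u) = ∫ u in a..x, F (x, u) := by
  rw [intervalIntegral.integral_of_le hx.1.le, integral_Ioc_eq_integral_Ioo,
    ← integral_indicator measurableSet_Ioo]
  congr 1
  ext u
  simp only [indicator, triangle, mem_ofPred_eq, mem_Ioo, hx.2, and_true]

lemma integral_indicator_triangle_right {a b u : ℝ} (F : ℝ × ℝ → ℝ) (hu : u ∈ Ioo a b) :
    ∫ x, (triangle a b).indicator F (x, u) = ∫ x in u..b, F (x, u) := by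
  rw [intervalIntegral.integral_of_le hu.2.le, integral_Ioc_eq_integral_Ioo,
    ← integral_indicator measurableSet_Ioo]
  congr 1
  ext x
  simp only [indicator, triangle, mem_ofPred_eq, mem_Ioo, hu.1, true_and]

lemma intervalIntegrable_triangle_left {a b : ℝ} (hab : a ≤ b) {F : ℝ × ℝ → ℝ}
    (hF : IntegrableOn F (triangle a b)) :
    IntervalIntegrable (fun x => ∫ u in a..x, F (x, u)) volume a b := by
  have h := (integrable_indicator_iff (measurableSet_triangle a b)).2 hF
  rw [Measure.volume_eq_prod] at h
  rw [intervalIntegrable_iff_integrableOn_Ioo_of_le hab]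
  refine (h.integral_prod_left.integrableOn (s := Ioo a b)).congr_fun ?_ measurableSet_Ioo
  exact fun x hx => integral_indicator_triangle_left F hx

lemma intervalIntegrable_triangle_right {a b : ℝ} (hab : a ≤ b) {F : ℝ × ℝ → ℝ}
    (hF : IntegrableOn F (triangle a b)) :
    IntervalIntegrable (fun u => ∫ x in u..b, F (x, u)) volume a b := by
  have h := (integrable_indicator_iff (measurableSet_triangle a b)).2 hF
  rw [Measure.volume_eq_prod] at h
  rw [intervalIntegrable_iff_integrableOn_Ioo_of_le hab]
  refine (h.integral_prod_right.integrableOn (s := Ioo a b)).congr_fun ?_ measurableSet_Ioo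
  exact fun x hx => integral_indicator_triangle_right F hx

lemma integral_triangle_left {a b : ℝ} (hab : a ≤ b) {F : ℝ × ℝ → ℝ}
    (hF : IntegrableOn F (triangle a b)) :
    ∫ p in triangle a b, F p = ∫ x in a..b, ∫ u in a..x, F (x, u) := by
  have h := (integrable_indicator_iff (measurableSet_triangle a b)).2 hF
  rw [Measure.volume_eq_prod] at h
  rw [← integral_indicator (measurableSet_triangle a b), Measure.volume_eq_prod,
    integral_prod _ h, intervalIntegral.integral_of_le hab, integral_Ioc_eq_integral_Ioo,
    ← setIntegral_eq_integral_of_forall_compl_eq_zero (s := Ioo a b)]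
  · exact setIntegral_congr_fun measurableSet_Ioo
      fun x hx => integral_indicator_triangle_left F hx
  · intro x hx
    have : ∀ u, (triangle a b).indicator F (x, u) = 0 := fun u =>
      indicator_of_notMem (fun hp => hx ⟨hp.1.trans hp.2.1, hp.2.2⟩) _
    simp [this]

lemma integral_triangle_right {a b : ℝ} (hab : a ≤ b) {F : ℝ × ℝ → ℝ}
    (hF : IntegrableOn F (triangle a b)) :
    ∫ p in triangle a b, F p = ∫ u in a..b, ∫ x in u..b, F (x, u) := by
  have h := (integrable_indicator_iff (measurableSet_triangle a b)).2 hF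
  rw [Measure.volume_eq_prod] at h
  rw [← integral_indicator (measurableSet_triangle a b), Measure.volume_eq_prod,
    integral_prod_symm _ h, intervalIntegral.integral_of_le hab, integral_Ioc_eq_integral_Ioo,
    ← setIntegral_eq_integral_of_forall_compl_eq_zero (s := Ioo a b)]
  · exact setIntegral_congr_fun measurableSet_Ioo
      fun x hx => integral_indicator_triangle_right F hx
  · intro u hu
    have : ∀ x, (triangle a b).indicator F (x, u) = 0 := fun x =>
      indicator_of_notMem (fun hp => hu ⟨hp.1, hp.2.1.trans hp.2.2⟩) _
    simp [this]

/-- Finiteness of the Gagliardo-type seminorm. -/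
def GagliardoFinite (α : ℝ) (f : ℝ → ℝ) (a b : ℝ) : Prop :=
  IntegrableOn (fun p : ℝ × ℝ => (f p.1 - f p.2) / (p.1 - p.2) ^ (1 + α)) (triangle a b)

lemma GagliardoFinite.mono {α : ℝ} {f : ℝ → ℝ} {a b a' b' : ℝ} (h : GagliardoFinite α f a b)
    (ha : a ≤ a') (hb : b' ≤ b) : GagliardoFinite α f a' b' :=
  IntegrableOn.mono_set h (triangle_mono ha hb)

lemma gagliardo_nonneg (α : ℝ) (f : ℝ → ℝ) (a b : ℝ) : 0 ≤ gagliardo α f a b :=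
  integral_nonneg fun _ => abs_nonneg _

lemma gagliardo_mono {α : ℝ} {f : ℝ → ℝ} {a b a' b' : ℝ} (h : GagliardoFinite α f a b)
    (ha : a ≤ a') (hb : b' ≤ b) : gagliardo α f a' b' ≤ gagliardo α f a b :=
  setIntegral_mono_set h.abs (Eventually.of_forall fun _ => abs_nonneg _)
    (triangle_mono ha hb).eventuallyLE

/-- The two small triangles are disjoint subsets of the large one. This superadditivity is what lets
the seminorm enter a sewing control. -/
lemma gagliardo_add_le {α : ℝ} {f : ℝ → ℝ} {a m b : ℝ} (h : GagliardoFinite α f a b)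
    (ham : a ≤ m) (hmb : m ≤ b) :
    gagliardo α f a m + gagliardo α f m b ≤ gagliardo α f a b := by
  have hd : Disjoint (triangle a m) (triangle m b) := by
    rw [Set.disjoint_left]
    rintro p ⟨_, h2, h3⟩ ⟨h4, _, _⟩
    linarith
  rw [gagliardo, gagliardo, ← setIntegral_union hd (measurableSet_triangle m b)
    (h.mono le_rfl hmb).abs (h.mono ham le_rfl).abs]
  exact setIntegral_mono_set h.abs (Eventually.of_forall fun _ => abs_nonneg _)
    (union_subset (triangle_mono le_rfl hmb) (triangle_mono ham le_rfl)).eventuallyLE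

/-! ### Bounds for the fractional integral and continuity in the integrator -/

lemma intervalIntegrable_div_rpow {α a b : ℝ} (hab : a ≤ b) (hα1 : α < 1) {f : ℝ → ℝ}
    (hf : Continuous f) : IntervalIntegrable (fun x => f x / (x - a) ^ α) volume a b := by
  simp only [div_eq_mul_inv]
  have : IntervalIntegrable (fun x => ((x - a) ^ α)⁻¹) volume a b := by
    refine (intervalIntegrable_sub_left_rpow (p := -α) (by linarith) a a b).congr ?_
    intro x hx
    rw [uIoc_of_le hab] at hx
    exact Real.rpow_neg (sub_pos.2 hx.1).le _
  exact this.continuousOn_mul hf.continuousOn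

lemma intervalIntegrable_leftCore {α a b : ℝ} (hab : a ≤ b) (hα1 : α < 1) {f : ℝ → ℝ}
    (hf : Continuous f) (hG : GagliardoFinite α f a b) :
    IntervalIntegrable (leftCore α a f) volume a b :=
  (intervalIntegrable_div_rpow hab hα1 hf).add
    ((intervalIntegrable_triangle_left hab hG).const_mul α)

lemma integral_abs_leftCore_le {α a b K : ℝ} (hab : a ≤ b) (hα : 0 < α) (hα1 : α < 1)
    {f : ℝ → ℝ} (hf : Continuous f) (hK : ∀ x, |f x| ≤ K) (hG : GagliardoFinite α f a b) :
    ∫ x in a..b, |leftCore α a f x| ≤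
      K * ((b - a) ^ (1 - α) / (1 - α)) + α * gagliardo α f a b := by
  have hK0 : 0 ≤ K := (abs_nonneg _).trans (hK 0)
  have hi := intervalIntegrable_sub_left_rpow (p := -α) (by linarith) a a b
  have hj := intervalIntegrable_triangle_left hab hG.abs
  calc ∫ x in a..b, |leftCore α a f x| ≤ ∫ x in a..b, (K * (x - a) ^ (-α) +
        α * ∫ u in a..x, |(f x - f u) / (x - u) ^ (1 + α)|) := by
        refine intervalIntegral.integral_mono_on_of_le_Ioo hab
          (intervalIntegrable_leftCore hab hα1 hf hG).abs
          ((hi.const_mul K).add (hj.const_mul α)) fun x hx => ?_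
        refine (abs_add_le _ _).trans (add_le_add ?_ ?_)
        · have := abs_div_rpow_le (M := K) (β := 0) (γ := α) (sub_pos.2 hx.1)
            (by simpa using hK x)
          simpa using this
        · rw [abs_mul, abs_of_pos hα]
          gcongr
          exact intervalIntegral.abs_integral_le_integral_abs hx.1.le
    _ = _ := by
        rw [intervalIntegral.integral_add (hi.const_mul K) (hj.const_mul α),
          intervalIntegral.integral_const_mul, intervalIntegral.integral_const_mul,
          integral_sub_left_rpow (by linarith), gagliardo, integral_triangle_left hab hG.abs,
          show -α + 1 = 1 - α by ring]

/-- The sup norm of the right derivative times the `L¹` norm of the left one. It is the only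
estimate that needs no regularity of `f` beyond a finite seminorm, hence the starting point of the
bootstrap. -/
lemma abs_realGls_le {α β a b K M : ℝ} (hab : a ≤ b) (hα : 0 < α) (hα1 : α < 1)
    (hαβ : 1 < α + β) (hM : 0 ≤ M) {f g : ℝ → ℝ} (hf : Continuous f) (hK : ∀ x, |f x| ≤ K)
    (hG : GagliardoFinite α f a b) (hg : HolderBound M β a b g) :
    |realGls α a b f g| ≤ M * (1 + (1 - α) / (α + β - 1)) * (b - a) ^ (α + β - 1) *
      (K * ((b - a) ^ (1 - α) / (1 - α)) + α * gagliardo α f a b) := by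
  have h0 : 0 ≤ M * (1 + (1 - α) / (α + β - 1)) := by
    have : 0 ≤ 1 - α := by linarith
    have : 0 ≤ α + β - 1 := by linarith
    positivity
  have h1 : |realGls α a b f g| ≤ ∫ x in a..b,
      M * (1 + (1 - α) / (α + β - 1)) * (b - a) ^ (α + β - 1) * |leftCore α a f x| := by
    rw [← Real.norm_eq_abs]
    refine intervalIntegral.norm_integral_le_of_norm_le hab (Eventually.of_forall fun x hx => ?_)
      ((intervalIntegrable_leftCore hab hα1 hf hG).abs.const_mul _)
    rw [norm_mul, mul_comm]
    refine mul_le_mul_of_nonneg_right ?_ (norm_nonneg _)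
    refine ((hg.mono hx.1.le le_rfl).abs_rightCore_le hα1 hαβ hx.2).trans ?_
    refine mul_le_mul_of_nonneg_left ?_ h0
    exact Real.rpow_le_rpow (by linarith [hx.2]) (by linarith [hx.1]) (by linarith)
  rw [intervalIntegral.integral_const_mul] at h1
  refine h1.trans (mul_le_mul_of_nonneg_left
    (integral_abs_leftCore_le hab hα hα1 hf hK hG) (mul_nonneg h0 ?_))
  exact Real.rpow_nonneg (by linarith) _

lemma tendsto_realGls {α β a b M : ℝ} (hab : a ≤ b) (hα1 : α < 1)
    (hαβ : 1 < α + β) (hM : 0 ≤ M) {f g : ℝ → ℝ} {gn : ℕ → ℝ → ℝ} (hf : Continuous f)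
    (hG : GagliardoFinite α f a b) (hgn : ∀ n, HolderBound M β a b (gn n))
    (hc : ∀ n, Continuous (gn n)) (hlim : ∀ y, Tendsto (fun n => gn n y) atTop (𝓝 (g y))) :
    Tendsto (fun n => realGls α a b f (gn n)) atTop (𝓝 (realGls α a b f g)) := by
  have h0 : 0 ≤ M * (1 + (1 - α) / (α + β - 1)) := by
    have : 0 ≤ 1 - α := by linarith
    have : 0 ≤ α + β - 1 := by linarith
    positivity
  have hL := intervalIntegrable_leftCore hab hα1 hf hG
  refine intervalIntegral.tendsto_integral_filter_of_dominated_convergence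
    (fun x => M * (1 + (1 - α) / (α + β - 1)) * (b - a) ^ (α + β - 1) * |leftCore α a f x|)
    (Eventually.of_forall fun n => ?_)
    (Eventually.of_forall fun n => Eventually.of_forall fun x hx => ?_)
    (hL.abs.const_mul _)
    (Eventually.of_forall fun x hx => ?_)
  · rw [uIoc_of_le hab]
    exact ((intervalIntegrable_iff_integrableOn_Ioc_of_le hab).1 hL).aestronglyMeasurable.mul
      (aestronglyMeasurable_rightCore (hc n))
  · rw [uIoc_of_le hab] at hx
    rw [norm_mul, mul_comm]
    refine mul_le_mul_of_nonneg_right ?_ (norm_nonneg _)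
    refine (((hgn n).mono hx.1.le le_rfl).abs_rightCore_le hα1 hαβ hx.2).trans ?_
    refine mul_le_mul_of_nonneg_left ?_ h0
    exact Real.rpow_le_rpow (by linarith [hx.2]) (by linarith [hx.1]) (by linarith)
  · rw [uIoc_of_le hab] at hx
    refine Tendsto.const_mul _ ?_
    rcases hx.2.eq_or_lt with rfl | hxb
    · simp [rightCore]
    · exact tendsto_rightCore hαβ hxb (fun n => (hgn n).mono hx.1.le le_rfl) hc hlim

/-! ### Smooth integrators: reduction to an ordinary integral -/

/-- Integration by parts with `(g x - g u) (u - x)^(α-1)`; since `g` is Lipschitz on `[x, b]` this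
is `O((u - x)^α)` and vanishes at `u = x`. -/
lemma rightCore_eq_neg_integral {α b x : ℝ} (hα : 0 < α) (hxb : x < b)
    {g g' : ℝ → ℝ} (hg : ∀ y, HasDerivAt g (g' y) y) (hg' : Continuous g') :
    rightCore α b g x = -∫ v in x..b, g' v * (v - x) ^ (α - 1) := by
  obtain ⟨M, hM⟩ : ∃ M, HolderBound M 1 x b g := by
    obtain ⟨M, hM⟩ := (isCompact_Icc (a := x) (b := b)).exists_bound_of_continuousOn
      hg'.continuousOn
    refine ⟨M, fun u v hu huv hv => ?_⟩
    have := (convex_Icc x b).norm_image_sub_le_of_norm_hasDerivWithin_le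
      (fun y _ => (hg y).hasDerivWithinAt) hM ⟨hu, huv.trans hv⟩ ⟨hu.trans huv, hv⟩
    simpa [abs_of_nonneg (sub_nonneg.2 huv)] using this
  have hgc : Continuous g := continuous_iff_continuousAt.2 fun y => (hg y).continuousAt
  have hi1 : IntervalIntegrable (fun v => g' v * (v - x) ^ (α - 1)) volume x b :=
    (intervalIntegrable_sub_left_rpow (by linarith) x x b).continuousOn_mul hg'.continuousOn
  have hi2 : IntervalIntegrable (fun u => (g x - g u) / (u - x) ^ (2 - α)) volume x b := by
    refine ((intervalIntegrable_sub_left_rpow (p := α - 1)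
      (by linarith) x x b).const_mul M).mono_fun ?_ ?_
    · refine Measurable.aestronglyMeasurable ?_
      have := hgc.measurable
      fun_prop
    · rw [uIoc_of_le hxb.le]
      filter_upwards [ae_restrict_mem measurableSet_Ioc] with u hu
      have := abs_div_rpow_le (γ := 2 - α) (sub_pos.2 hu.1)
        (by rw [abs_sub_comm]; exact hM x u le_rfl hu.1.le hu.2 : |g x - g u| ≤ M * (u - x) ^ (1:ℝ))
      rw [show (1:ℝ) - (2 - α) = α - 1 by ring] at this
      exact this.trans (le_abs_self _)
  have key := intervalIntegral.integral_eq_sub_of_hasDerivAt_of_le hxb.le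
    (f := fun u => (g x - g u) * (u - x) ^ (α - 1))
    (f' := fun u => -(g' u * (u - x) ^ (α - 1)) +
      (α - 1) * ((g x - g u) / (u - x) ^ (2 - α))) ?_ ?_
    (hi1.neg.add (hi2.const_mul (α - 1)))
  · have hi1' : IntervalIntegrable (fun v => -(g' v * (v - x) ^ (α - 1))) volume x b := hi1.neg
    rw [intervalIntegral.integral_add hi1' (hi2.const_mul _),
      intervalIntegral.integral_const_mul, intervalIntegral.integral_neg] at key
    have hb : (g x - g b) / (b - x) ^ (1 - α) = (g x - g b) * (b - x) ^ (α - 1) := by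
      rw [div_eq_mul_inv, ← Real.rpow_neg (sub_pos.2 hxb).le, neg_sub]
    rw [rightCore, hb]
    simp only [sub_self, zero_mul, sub_zero] at key
    linarith
  · intro u hu
    rcases hu.1.eq_or_lt with rfl | hxu
    · have h0 : Tendsto (fun u => M * (u - x) ^ α) (𝓝[Icc x b] x) (𝓝 0) := by
        have : ContinuousAt (fun u : ℝ => M * (u - x) ^ α) x := by
          refine continuousAt_const.mul (ContinuousAt.rpow_const (by fun_prop) (Or.inr hα.le))
        have h := this.tendsto
        simp only [sub_self, Real.zero_rpow hα.ne', mul_zero] at h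
        exact h.mono_left nhdsWithin_le_nhds
      rw [ContinuousWithinAt]
      simp only [sub_self, zero_mul]
      refine squeeze_zero_norm' ?_ h0
      filter_upwards [self_mem_nhdsWithin] with u hu
      rcases hu.1.eq_or_lt with rfl | hxu
      · simp [Real.zero_rpow hα.ne']
      · rw [norm_mul, Real.norm_eq_abs, abs_sub_comm, Real.norm_of_nonneg
          (Real.rpow_nonneg (sub_pos.2 hxu).le _)]
        calc _ ≤ M * (u - x) ^ (1:ℝ) * (u - x) ^ (α - 1) := by
              gcongr
              exact hM x u le_rfl hxu.le hu.2
          _ = _ := by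
              rw [mul_assoc, ← Real.rpow_add (sub_pos.2 hxu)]
              congr 2
              ring
    · refine ContinuousAt.continuousWithinAt ?_
      refine ContinuousAt.mul (by fun_prop) (ContinuousAt.rpow_const (by fun_prop) (Or.inl ?_))
      linarith
  · intro u hu
    have hxu : u - x ≠ 0 := by linarith [hu.1]
    have h1 : HasDerivAt (fun u => (u - x) ^ (α - 1)) ((α - 1) * (u - x) ^ (α - 1 - 1)) u := by
      have := ((hasDerivAt_id u).sub_const x).rpow_const (p := α - 1) (Or.inl hxu)
      simpa using this
    have h2 := ((hg u).const_sub (g x)).mul h1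
    refine h2.congr_deriv ?_
    rw [div_eq_mul_inv, ← Real.rpow_neg (by linarith [hu.1]),
      show -(2 - α) = α - 1 - 1 by ring]
    ring

/-- The integrand has an explicit antiderivative, a multiple of `((v - y) / (y - x + η))^α`. The
shift `η` removes the singularity of the left kernel, so that terms can be separated before letting
`η ↓ 0`. -/
lemma integral_rpow_mul_shifted_rpow {α x v η : ℝ} (hα : 0 < α) (hη : 0 < η)
    (hxv : x ≤ v) :
    α * ∫ y in x..v, (v - y) ^ (α - 1) * (y - x + η) ^ (-1 - α) =
      (v - x) ^ α * η ^ (-α) / (v - x + η) := by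
  have hpos : ∀ y ∈ Icc x v, 0 < y - x + η := fun y hy => by linarith [hy.1]
  have key := intervalIntegral.integral_eq_sub_of_hasDerivAt_of_le hxv
    (f := fun y => -((v - y) / (y - x + η)) ^ α / (v - x + η))
    (f' := fun y => α * ((v - y) ^ (α - 1) * (y - x + η) ^ (-1 - α))) ?_ ?_ ?_
  · rw [intervalIntegral.integral_const_mul] at key
    rw [key, sub_self, zero_div, Real.zero_rpow hα.ne', sub_self, zero_add,
      Real.div_rpow (by linarith) hη.le, Real.rpow_neg hη.le]
    simp
    ring
  · refine ContinuousOn.div_const (ContinuousOn.neg ?_) _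
    refine ContinuousOn.rpow_const ?_ fun _ _ => Or.inr hα.le
    exact ContinuousOn.div (by fun_prop) (by fun_prop) fun y hy => (hpos y hy).ne'
  · intro y hy
    have hy' := hpos y (Ioo_subset_Icc_self hy)
    have hvy : 0 < v - y := by linarith [hy.2]
    have hq : 0 < (v - y) / (y - x + η) := div_pos hvy hy'
    have h1 : HasDerivAt (fun y => (v - y) / (y - x + η))
        (-(v - x + η) / (y - x + η) ^ 2) y := by
      have := ((hasDerivAt_id y).const_sub v).div (((hasDerivAt_id y).sub_const x).add_const η)
        hy'.ne'
      refine this.congr_deriv ?_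
      simp only [id]
      ring
    have h2 := ((h1.rpow_const (p := α) (Or.inl hq.ne')).neg).div_const (v - x + η)
    refine h2.congr_deriv ?_
    have hk : (y - x + η) ^ (-1 - α) = ((y - x + η) ^ (α - 1))⁻¹ / (y - x + η) ^ 2 := by
      rw [← Real.rpow_neg hy'.le, ← Real.rpow_two, ← Real.rpow_sub hy']
      congr 1
      ring
    rw [Real.div_rpow hvy.le hy'.le, hk]
    have : v - x + η ≠ 0 := by linarith [hy.1, hy.2]
    have := (Real.rpow_pos_of_pos hy' (α - 1)).ne'
    field_simp
  · refine IntervalIntegrable.const_mul ?_ _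
    refine (intervalIntegrable_sub_right_rpow (by linarith) v x v).mul_continuousOn ?_
    rw [uIcc_of_le hxv]
    exact ContinuousOn.rpow_const (by fun_prop) fun y hy => Or.inl (hpos y hy).ne'

lemma integral_shifted_rpow {α a x η : ℝ} (hα : 0 < α) (hη : 0 < η) (hax : a ≤ x) :
    α * ∫ u in a..x, (x - u + η) ^ (-1 - α) = η ^ (-α) - (x - a + η) ^ (-α) := by
  have h1 : ∫ u in a..x, (x - u + η) ^ (-1 - α) = ∫ u in a..x, (x + η - u) ^ (-1 - α) := by
    congr 1
    ext u
    ring_nf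
  rw [h1, intervalIntegral.integral_comp_sub_left (fun u => u ^ (-1 - α)), integral_rpow]
  · rw [show -1 - α + 1 = -α by ring, show x + η - x = η by ring,
      show x + η - a = x - a + η by ring]
    field_simp
    ring
  · right
    refine ⟨by linarith, ?_⟩
    rw [uIcc_of_le (by linarith)]
    rintro ⟨h, _⟩
    linarith

/-- On the triangle this agrees with the integrand of a convolution of two integrable functions. -/
lemma integrableOn_triangle_rpow {p : ℝ} (hp : -1 < p) (a b : ℝ) :
    IntegrableOn (fun q : ℝ × ℝ => (q.1 - q.2) ^ p) (triangle a b) := by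
  have h1 : Integrable ((Ioo a b).indicator (1 : ℝ → ℝ)) volume :=
    (integrable_indicator_iff measurableSet_Ioo).2
      (integrableOn_const (by simp) : IntegrableOn (fun _ : ℝ => (1 : ℝ)) (Ioo a b) volume)
  have h2 : Integrable ((Ioc 0 (b - a)).indicator (fun r : ℝ => r ^ p)) volume := by
    rw [integrable_indicator_iff measurableSet_Ioc]
    exact (intervalIntegral.intervalIntegrable_rpow' hp).1
  have h3 := h1.convolution_integrand (ContinuousLinearMap.mul ℝ ℝ) h2
  rw [← Measure.volume_eq_prod] at h3
  refine (h3.integrableOn (s := triangle a b)).congr_fun ?_ (measurableSet_triangle a b)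
  rintro ⟨x, u⟩ ⟨h1, h2, h3⟩
  simp only at h1 h2 h3
  have m1 : u ∈ Ioo a b := ⟨h1, h2.trans h3⟩
  have m2 : x - u ∈ Ioc 0 (b - a) := ⟨by linarith, by linarith⟩
  simp [indicator_of_mem m1, indicator_of_mem m2]

lemma IntegrableOn.bdd_mul_triangle {F m : ℝ × ℝ → ℝ} {a b C : ℝ}
    (hF : IntegrableOn F (triangle a b)) (hm : Measurable m) (hC : ∀ p ∈ triangle a b, |m p| ≤ C) :
    IntegrableOn (fun p => m p * F p) (triangle a b) := by
  refine Integrable.bdd_mul (c := C) hF hm.aestronglyMeasurable ?_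
  filter_upwards [ae_restrict_mem (measurableSet_triangle a b)] with p hp using hC p hp

/-- `∫_x^b φ(v) (v - x)^{α-1} dv`, a fractional integral up to a constant. -/
noncomputable def fracInt (α b : ℝ) (φ : ℝ → ℝ) (x : ℝ) : ℝ :=
  ∫ v in Ioc x b, φ v * (v - x) ^ (α - 1)

lemma fracInt_eq {α b x : ℝ} (φ : ℝ → ℝ) (hxb : x ≤ b) :
    fracInt α b φ x = ∫ v in x..b, φ v * (v - x) ^ (α - 1) := by
  rw [fracInt, intervalIntegral.integral_of_le hxb]

lemma measurable_fracInt {α b : ℝ} {φ : ℝ → ℝ} (hφ : Continuous φ) :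
    Measurable (fracInt α b φ) := by
  have hφm := hφ.measurable
  have h1 : StronglyMeasurable (fun x => ∫ u, Set.indicator {p : ℝ × ℝ | p.1 < p.2 ∧ p.2 ≤ b}
      (fun p => φ p.2 * (p.2 - p.1) ^ (α - 1)) (x, u)) := by
    refine StronglyMeasurable.integral_prod_right ?_
    refine Measurable.stronglyMeasurable (Measurable.indicator (by fun_prop) ?_)
    exact (measurableSet_lt measurable_fst measurable_snd).inter
      (measurableSet_le measurable_snd measurable_const)
  convert h1.measurable using 1
  ext x
  rw [fracInt, ← integral_indicator measurableSet_Ioc]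
  rfl

lemma abs_fracInt_le {α a b x G : ℝ} (hα : 0 < α) {φ : ℝ → ℝ} (hG : ∀ v ∈ Icc a b, |φ v| ≤ G)
    (hax : a ≤ x) (hxb : x ≤ b) : |fracInt α b φ x| ≤ G * ((b - a) ^ α / α) := by
  have hG0 : 0 ≤ G := (abs_nonneg _).trans (hG x ⟨hax, hxb⟩)
  have h1 : |fracInt α b φ x| ≤ ∫ v in x..b, G * (v - x) ^ (α - 1) := by
    rw [fracInt_eq φ hxb, ← Real.norm_eq_abs]
    refine intervalIntegral.norm_integral_le_of_norm_le hxb (Eventually.of_forall fun v hv => ?_)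
      ((intervalIntegrable_sub_left_rpow (by linarith) x x b).const_mul G)
    have : 0 ≤ (v - x) ^ (α - 1) := Real.rpow_nonneg (by linarith [hv.1]) _
    rw [norm_mul, Real.norm_of_nonneg this]
    exact mul_le_mul_of_nonneg_right (hG v ⟨by linarith [hv.1], hv.2⟩) this
  rw [intervalIntegral.integral_const_mul, integral_sub_left_rpow (by linarith),
    sub_add_cancel] at h1
  refine h1.trans ?_
  have : b - x ≤ b - a := by linarith
  have : 0 ≤ b - x := by linarith
  gcongr

lemma integral_fracInt_mul_shifted_rpow {α b x η : ℝ} (hα : 0 < α) (hη : 0 < η) (hxb : x ≤ b)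
    {φ : ℝ → ℝ} (hφ : Continuous φ) :
    α * ∫ y in x..b, fracInt α b φ y * (y - x + η) ^ (-1 - α) =
      ∫ v in x..b, φ v * ((v - x) ^ α * η ^ (-α) / (v - x + η)) := by
  obtain ⟨G, hG⟩ := (isCompact_Icc (a := x) (b := b)).exists_bound_of_continuousOn hφ.continuousOn
  have hφm := hφ.measurable
  have hF : IntegrableOn (fun p : ℝ × ℝ => (φ p.1 * (p.2 - x + η) ^ (-1 - α)) *
      (p.1 - p.2) ^ (α - 1)) (triangle x b) := by
    refine IntegrableOn.bdd_mul_triangle (C := G * η ^ (-1 - α))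
      (integrableOn_triangle_rpow (by linarith) x b) (by fun_prop) fun p hp => ?_
    have h0 : 0 < p.2 - x + η := by linarith [hp.1]
    rw [abs_mul, abs_of_pos (Real.rpow_pos_of_pos h0 _)]
    have h1 := hG p.1 ⟨(hp.1.trans hp.2.1).le, hp.2.2.le⟩
    have h2 : (p.2 - x + η) ^ (-1 - α) ≤ η ^ (-1 - α) :=
      Real.rpow_le_rpow_of_nonpos hη (by linarith [hp.1]) (by linarith)
    exact mul_le_mul h1 h2 (Real.rpow_nonneg h0.le _) ((norm_nonneg _).trans h1)
  have e1 := integral_triangle_right hxb hF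
  rw [integral_triangle_left hxb hF] at e1
  have e2 : ∫ y in x..b, fracInt α b φ y * (y - x + η) ^ (-1 - α) =
      ∫ u in x..b, ∫ v in u..b, (φ v * (u - x + η) ^ (-1 - α)) * (v - u) ^ (α - 1) := by
    refine intervalIntegral.integral_congr fun y hy => ?_
    rw [uIcc_of_le hxb] at hy
    rw [fracInt_eq φ hy.2, ← intervalIntegral.integral_mul_const]
    congr 1
    ext v
    ring
  rw [e2, ← e1, ← intervalIntegral.integral_const_mul]
  refine intervalIntegral.integral_congr fun v hv => ?_
  rw [uIcc_of_le hxb] at hv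
  simp only
  rw [← integral_rpow_mul_shifted_rpow hα hη hv.1, ← intervalIntegral.integral_const_mul,
    ← intervalIntegral.integral_const_mul, ← intervalIntegral.integral_const_mul]
  congr 1
  ext u
  ring

lemma intervalIntegrable_mul_rpow_div {α b x η : ℝ} (hα : 0 < α) (hη : 0 < η) (hxb : x ≤ b)
    {φ : ℝ → ℝ} (hφ : Continuous φ) :
    IntervalIntegrable (fun v => φ v * ((v - x) ^ α * η ^ (-α) / (v - x + η))) volume x b := by
  refine ContinuousOn.intervalIntegrable ?_
  rw [uIcc_of_le hxb]
  refine hφ.continuousOn.mul (ContinuousOn.div (ContinuousOn.mul ?_ continuousOn_const)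
    (by fun_prop) fun v hv => by linarith [hv.1])
  exact ContinuousOn.rpow_const (by fun_prop) fun _ _ => Or.inr hα.le

/-- The divergent factors `η^(-α)` combine, leaving a kernel concentrated at scale `η` near `v = x`:
an approximate identity. -/
lemma fracInt_mul_sub {α b x η : ℝ} (hα : 0 < α) (hη : 0 < η) (hxb : x ≤ b)
    {φ : ℝ → ℝ} (hφ : Continuous φ) :
    fracInt α b φ x * η ^ (-α) - ∫ v in x..b, φ v * ((v - x) ^ α * η ^ (-α) / (v - x + η)) =
      ∫ v in x..b, φ v * ((v - x) ^ (α - 1) * η ^ (1 - α) / (v - x + η)) := by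
  rw [fracInt_eq φ hxb, ← intervalIntegral.integral_mul_const,
    ← intervalIntegral.integral_sub _ (intervalIntegrable_mul_rpow_div hα hη hxb hφ)]
  · refine intervalIntegral.integral_congr_ae (Eventually.of_forall fun v hv => ?_)
    rw [uIoc_of_le hxb] at hv
    have h1 : 0 < v - x := sub_pos.2 hv.1
    have h2 : (v - x) ^ α = (v - x) ^ (α - 1) * (v - x) := by
      rw [← Real.rpow_add_one h1.ne', sub_add_cancel]
    have h3 : η ^ (1 - α) = η ^ (-α) * η := by
      rw [← Real.rpow_add_one hη.ne']
      congr 1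
      ring
    have : v - x + η ≠ 0 := by linarith
    rw [h2, h3]
    field_simp
    ring
  · exact ((intervalIntegrable_sub_left_rpow (by linarith) x x b).continuousOn_mul
      hφ.continuousOn).mul_const _

lemma integrableOn_rpow_div_add_one {α : ℝ} (hα : 0 < α) (hα1 : α < 1) :
    IntegrableOn (fun z : ℝ => z ^ (α - 1) / (z + 1)) (Ioi 0) := by
  rw [← Ioc_union_Ioi_eq_Ioi zero_le_one]
  have hm : AEStronglyMeasurable (fun z : ℝ => z ^ (α - 1) / (z + 1)) volume :=
    Measurable.aestronglyMeasurable (by fun_prop)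
  refine IntegrableOn.union ?_ ?_
  · refine Integrable.mono' (g := fun z => z ^ (α - 1))
      (intervalIntegral.intervalIntegrable_rpow' (by linarith)).1 hm.restrict ?_
    filter_upwards [ae_restrict_mem measurableSet_Ioc] with z hz
    have h0 : 0 ≤ z ^ (α - 1) := Real.rpow_nonneg hz.1.le _
    rw [Real.norm_of_nonneg (div_nonneg h0 (by linarith [hz.1]))]
    exact div_le_self h0 (by linarith [hz.1])
  · refine Integrable.mono' (g := fun z => z ^ (α - 2))
      (integrableOn_Ioi_rpow_of_lt (by linarith) zero_lt_one) hm.restrict ?_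
    filter_upwards [ae_restrict_mem measurableSet_Ioi] with z hz
    have hz0 : 0 < z := zero_lt_one.trans hz
    have h0 : 0 ≤ z ^ (α - 1) := Real.rpow_nonneg hz0.le _
    rw [Real.norm_of_nonneg (div_nonneg h0 (by linarith)), div_le_iff₀ (by linarith),
      show α - 1 = α - 2 + 1 by ring, Real.rpow_add_one hz0.ne']
    have : 0 ≤ z ^ (α - 2) := Real.rpow_nonneg hz0.le _
    nlinarith

lemma integral_approx_identity_eq {α b x η : ℝ} (hη : 0 < η) (hxb : x ≤ b) (φ : ℝ → ℝ) :
    ∫ v in x..b, φ v * ((v - x) ^ (α - 1) * η ^ (1 - α) / (v - x + η)) =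
      ∫ z in Ioi (0 : ℝ), (Iic ((b - x) / η)).indicator
        (fun z => φ (x + η * z) * (z ^ (α - 1) / (z + 1))) z := by
  rw [integral_indicator measurableSet_Iic, Measure.restrict_restrict measurableSet_Iic,
    inter_comm, Ioi_inter_Iic, ← intervalIntegral.integral_of_le (div_nonneg (by linarith) hη.le)]
  have h1 := intervalIntegral.smul_integral_comp_add_mul (a := 0) (b := (b - x) / η)
    (fun v => φ v * ((v - x) ^ (α - 1) * η ^ (1 - α) / (v - x + η))) η x
  rw [mul_zero, add_zero, mul_div_cancel₀ _ hη.ne', add_sub_cancel] at h1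
  rw [← h1, smul_eq_mul, ← intervalIntegral.integral_const_mul]
  refine intervalIntegral.integral_congr fun z hz => ?_
  rw [uIcc_of_le (div_nonneg (by linarith) hη.le)] at hz
  rw [add_sub_cancel_left, Real.mul_rpow hη.le hz.1]
  have h2 : η ^ (α - 1) * η ^ (1 - α) = 1 := by
    rw [← Real.rpow_add hη]
    simp
  have h3 : z + 1 ≠ 0 := by linarith [hz.1]
  have h4 : η * z + η ≠ 0 := by nlinarith [hz.1]
  calc _ = φ (x + η * z) * z ^ (α - 1) * (η ^ (α - 1) * η ^ (1 - α)) * (η / (η * z + η)) := by ring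
    _ = _ := by
      rw [h2, show η / (η * z + η) = 1 / (z + 1) by field_simp]
      ring

/-- After `v = x + η z` the kernel no longer depends on `η`, and dominated convergence applies. -/
lemma tendsto_integral_approx_identity {α b x G : ℝ} (hα : 0 < α) (hα1 : α < 1) (hxb : x < b)
    {φ : ℝ → ℝ} (hφ : Continuous φ) (hG : ∀ v ∈ Icc x b, |φ v| ≤ G) :
    Tendsto (fun η => ∫ v in x..b, φ v * ((v - x) ^ (α - 1) * η ^ (1 - α) / (v - x + η)))
      (𝓝[>] 0) (𝓝 (φ x * ∫ z in Ioi (0 : ℝ), z ^ (α - 1) / (z + 1))) := by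
  have hφm := hφ.measurable
  rw [← integral_const_mul]
  refine Tendsto.congr' (f₁ := fun η => ∫ z in Ioi (0 : ℝ), (Iic ((b - x) / η)).indicator
        (fun z => φ (x + η * z) * (z ^ (α - 1) / (z + 1))) z) ?_ ?_
  · filter_upwards [self_mem_nhdsWithin] with η hη
    exact (integral_approx_identity_eq hη hxb.le φ).symm
  refine tendsto_integral_filter_of_dominated_convergence
    (fun z => G * (z ^ (α - 1) / (z + 1))) ?_ ?_
    ((integrableOn_rpow_div_add_one hα hα1).const_mul G) ?_
  · refine Eventually.of_forall fun η => Measurable.aestronglyMeasurable ?_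
    exact Measurable.indicator (by fun_prop) measurableSet_Iic
  · filter_upwards [self_mem_nhdsWithin] with η hη
    filter_upwards [ae_restrict_mem measurableSet_Ioi] with z hz
    have hη' : 0 < η := hη
    have hz' : 0 < z := hz
    have h0 : 0 ≤ z ^ (α - 1) / (z + 1) :=
      div_nonneg (Real.rpow_nonneg hz'.le _) (by linarith)
    by_cases hzm : z ∈ Iic ((b - x) / η)
    · rw [indicator_of_mem hzm, norm_mul, Real.norm_of_nonneg h0]
      refine mul_le_mul_of_nonneg_right (hG _ ⟨?_, ?_⟩) h0
      · have := mul_pos hη' hz'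
        linarith
      · have := (le_div_iff₀ hη').1 hzm
        linarith
    · rw [indicator_of_notMem hzm, norm_zero]
      exact mul_nonneg ((abs_nonneg _).trans (hG x ⟨le_rfl, hxb.le⟩)) h0
  · filter_upwards [ae_restrict_mem measurableSet_Ioi] with z hz
    have hz' : 0 < z := hz
    have h1 : Tendsto (fun η : ℝ => φ (x + η * z) * (z ^ (α - 1) / (z + 1))) (𝓝[>] 0)
        (𝓝 (φ x * (z ^ (α - 1) / (z + 1)))) := by
      have : Continuous (fun η : ℝ => φ (x + η * z) * (z ^ (α - 1) / (z + 1))) := by fun_prop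
      have h := this.tendsto 0
      rw [zero_mul, add_zero] at h
      exact h.mono_left nhdsWithin_le_nhds
    refine h1.congr' ?_
    have h2 : Iio ((b - x) / z) ∈ 𝓝 (0 : ℝ) := Iio_mem_nhds (div_pos (by linarith) hz')
    filter_upwards [self_mem_nhdsWithin, nhdsWithin_le_nhds h2] with η hη hη2
    have hη' : 0 < η := hη
    rw [indicator_of_mem]
    rw [mem_Iic, le_div_iff₀ hη', mul_comm]
    exact ((lt_div_iff₀ hz').1 hη2).le

lemma abs_integral_approx_identity_le {α b x η G : ℝ} (hα : 0 < α) (hα1 : α < 1) (hη : 0 < η)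
    (hxb : x ≤ b) {φ : ℝ → ℝ} (hG : ∀ v ∈ Icc x b, |φ v| ≤ G) :
    |∫ v in x..b, φ v * ((v - x) ^ (α - 1) * η ^ (1 - α) / (v - x + η))| ≤
      G * ∫ z in Ioi (0 : ℝ), z ^ (α - 1) / (z + 1) := by
  rw [integral_approx_identity_eq hη hxb, ← integral_const_mul, ← Real.norm_eq_abs]
  refine norm_integral_le_of_norm_le ((integrableOn_rpow_div_add_one hα hα1).const_mul G) ?_
  filter_upwards [ae_restrict_mem measurableSet_Ioi] with z hz
  have hz' : 0 < z := hz
  have h0 : 0 ≤ z ^ (α - 1) / (z + 1) :=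
    div_nonneg (Real.rpow_nonneg hz'.le _) (by linarith)
  by_cases hzm : z ∈ Iic ((b - x) / η)
  · rw [indicator_of_mem hzm, norm_mul, Real.norm_of_nonneg h0]
    refine mul_le_mul_of_nonneg_right (hG _ ⟨?_, ?_⟩) h0
    · have := mul_pos hη hz'
      linarith
    · have := (le_div_iff₀ hη).1 hzm
      linarith
  · rw [indicator_of_notMem hzm, norm_zero]
    exact mul_nonneg ((abs_nonneg _).trans (hG x ⟨le_rfl, hxb⟩)) h0

lemma realGls_eq_neg {α a b : ℝ} (hα : 0 < α) (hab : a ≤ b) {f g g' : ℝ → ℝ}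
    (hg : ∀ y, HasDerivAt g (g' y) y) (hg' : Continuous g') :
    realGls α a b f g = -∫ x in a..b, leftCore α a f x * fracInt α b g' x := by
  rw [realGls, ← intervalIntegral.integral_neg]
  refine intervalIntegral.integral_congr fun x hx => ?_
  rw [uIcc_of_le hab] at hx
  rcases hx.2.eq_or_lt with rfl | hxb
  · simp [rightCore, fracInt]
  · rw [rightCore_eq_neg_integral hα hxb hg hg', ← fracInt_eq g' hx.2, mul_neg]

lemma integrableOn_triangle_of_bounded {m : ℝ × ℝ → ℝ} {a b C : ℝ} (hm : Measurable m)
    (hC : ∀ p ∈ triangle a b, |m p| ≤ C) : IntegrableOn m (triangle a b) := by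
  have h := IntegrableOn.bdd_mul_triangle (integrableOn_triangle_rpow (p := 0) (by norm_num) a b)
    hm hC
  simpa using h

/-- The regularized version of the fractional integral splits into an error term and an
approximation of `∫ f φ`. -/
lemma regularized_integral_eq {α a b η : ℝ} (hα : 0 < α) (hη : 0 < η)
    (hab : a ≤ b) {f φ : ℝ → ℝ} (hf : Continuous f) (hφ : Continuous φ) :
    α * ∫ p in triangle a b, fracInt α b φ p.1 * ((f p.1 - f p.2) * (p.1 - p.2 + η) ^ (-1 - α)) =
      (∫ x in a..b, f x * ∫ v in x..b, φ v * ((v - x) ^ (α - 1) * η ^ (1 - α) / (v - x + η)))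
      - ∫ x in a..b, f x * fracInt α b φ x * (x - a + η) ^ (-α) := by
  obtain ⟨G, hG⟩ := (isCompact_Icc (a := a) (b := b)).exists_bound_of_continuousOn hφ.continuousOn
  obtain ⟨K, hK⟩ := (isCompact_Icc (a := a) (b := b)).exists_bound_of_continuousOn hf.continuousOn
  have hfm := hf.measurable
  have hhm := measurable_fracInt (α := α) (b := b) hφ
  have hh : ∀ x ∈ Icc a b, |fracInt α b φ x| ≤ G * ((b - a) ^ α / α) := fun x hx =>
    abs_fracInt_le hα hG hx.1 hx.2
  have hk : ∀ p ∈ triangle a b, |(p.1 - p.2 + η) ^ (-1 - α)| ≤ η ^ (-1 - α) := by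
    intro p hp
    have h0 : 0 < p.1 - p.2 + η := by linarith [hp.2.1]
    rw [abs_of_pos (Real.rpow_pos_of_pos h0 _)]
    exact Real.rpow_le_rpow_of_nonpos hη (by linarith [hp.2.1]) (by linarith)
  have m1 : ∀ p ∈ triangle a b, p.1 ∈ Icc a b := fun p hp =>
    ⟨(hp.1.trans hp.2.1).le, hp.2.2.le⟩
  have m2 : ∀ p ∈ triangle a b, p.2 ∈ Icc a b := fun p hp =>
    ⟨hp.1.le, (hp.2.1.trans hp.2.2).le⟩
  have i1 : IntegrableOn (fun p : ℝ × ℝ => (fracInt α b φ p.1 * f p.1) *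
      (p.1 - p.2 + η) ^ (-1 - α)) (triangle a b) := by
    refine integrableOn_triangle_of_bounded (C := G * ((b - a) ^ α / α) * K * η ^ (-1 - α))
      (by fun_prop) fun p hp => ?_
    rw [abs_mul, abs_mul]
    have := hh _ (m1 p hp)
    exact mul_le_mul (mul_le_mul this (hK _ (m1 p hp)) (abs_nonneg _)
      ((abs_nonneg _).trans this)) (hk p hp) (abs_nonneg _)
      (mul_nonneg ((abs_nonneg _).trans this) ((abs_nonneg _).trans (hK _ (m1 p hp))))
  have i2 : IntegrableOn (fun p : ℝ × ℝ => (fracInt α b φ p.1 * f p.2) *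
      (p.1 - p.2 + η) ^ (-1 - α)) (triangle a b) := by
    refine integrableOn_triangle_of_bounded (C := G * ((b - a) ^ α / α) * K * η ^ (-1 - α))
      (by fun_prop) fun p hp => ?_
    rw [abs_mul, abs_mul]
    have := hh _ (m1 p hp)
    exact mul_le_mul (mul_le_mul this (hK _ (m2 p hp)) (abs_nonneg _)
      ((abs_nonneg _).trans this)) (hk p hp) (abs_nonneg _)
      (mul_nonneg ((abs_nonneg _).trans this) ((abs_nonneg _).trans (hK _ (m2 p hp))))
  -- The terms with `f x` and `f u` are separately integrable only because `η > 0`. The second is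
  -- integrated in `x` first, so that both become integrals against `f` at a single point.
  have e0 : ∫ p in triangle a b, fracInt α b φ p.1 *
      ((f p.1 - f p.2) * (p.1 - p.2 + η) ^ (-1 - α)) =
      (∫ x in a..b, ∫ u in a..x, (fracInt α b φ x * f x) * (x - u + η) ^ (-1 - α)) -
      ∫ u in a..b, ∫ x in u..b, (fracInt α b φ x * f u) * (x - u + η) ^ (-1 - α) := by
    rw [← integral_triangle_left hab i1, ← integral_triangle_right hab i2, ← integral_sub i1 i2]
    congr 1
    ext p
    ring
  have j1 := intervalIntegrable_triangle_left hab i1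
  have j2 := intervalIntegrable_triangle_right hab i2
  have j3 : IntervalIntegrable (fun x => f x * fracInt α b φ x * (x - a + η) ^ (-α))
      volume a b := by
    rw [intervalIntegrable_iff_integrableOn_Ioc_of_le hab]
    refine Integrable.mono' (g := fun _ => K * (G * ((b - a) ^ α / α)) * η ^ (-α))
      (integrableOn_const (by simp)) (Measurable.aestronglyMeasurable (by fun_prop)) ?_
    filter_upwards [ae_restrict_mem measurableSet_Ioc] with x hx
    have hx' : x ∈ Icc a b := Ioc_subset_Icc_self hx
    have h0 : 0 < x - a + η := by linarith [hx.1]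
    rw [norm_mul, norm_mul, Real.norm_of_nonneg (Real.rpow_pos_of_pos h0 _).le]
    have h1 := hK x hx'
    have h2 := hh x hx'
    refine mul_le_mul (mul_le_mul h1 h2 (norm_nonneg _) ((norm_nonneg _).trans h1))
      (Real.rpow_le_rpow_of_nonpos hη (by linarith [hx.1]) (by linarith))
      (Real.rpow_nonneg h0.le _) (mul_nonneg ((norm_nonneg _).trans h1)
        ((abs_nonneg _).trans h2))
  rw [e0, ← intervalIntegral.integral_sub j1 j2, ← intervalIntegral.integral_const_mul,
    eq_sub_iff_add_eq, ← intervalIntegral.integral_add ((j1.sub j2).const_mul α) j3]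
  refine intervalIntegral.integral_congr fun x hx => ?_
  rw [uIcc_of_le hab] at hx
  have e1 : α * ∫ u in a..x, (fracInt α b φ x * f x) * (x - u + η) ^ (-1 - α) =
      f x * fracInt α b φ x * (η ^ (-α) - (x - a + η) ^ (-α)) := by
    rw [intervalIntegral.integral_const_mul, ← integral_shifted_rpow hα hη hx.1]
    ring
  have e2 : α * ∫ y in x..b, (fracInt α b φ y * f x) * (y - x + η) ^ (-1 - α) =
      f x * ∫ v in x..b, φ v * ((v - x) ^ α * η ^ (-α) / (v - x + η)) := by
    rw [← integral_fracInt_mul_shifted_rpow hα hη hx.2 hφ,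
      ← intervalIntegral.integral_const_mul, ← intervalIntegral.integral_const_mul,
      ← intervalIntegral.integral_const_mul]
    congr 1
    ext y
    ring
  simp only
  rw [← fracInt_mul_sub hα hη hx.2 hφ, mul_sub, e1, e2]
  ring

/-- For a continuously differentiable integrator, the generalized Lebesgue-Stieltjes integral is
a constant multiple of the usual integral. -/
theorem realGls_of_hasDerivAt {α a b : ℝ} (hα : 0 < α) (hα1 : α < 1) (hab : a ≤ b)
    {f g g' : ℝ → ℝ} (hf : Continuous f) (hG : GagliardoFinite α f a b)
    (hg : ∀ y, HasDerivAt g (g' y) y) (hg' : Continuous g') :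
    realGls α a b f g =
      -(∫ z in Ioi (0 : ℝ), z ^ (α - 1) / (z + 1)) * ∫ x in a..b, f x * g' x := by
  obtain ⟨G, hGb⟩ := (isCompact_Icc (a := a) (b := b)).exists_bound_of_continuousOn
    hg'.continuousOn
  have hfm := hf.measurable
  have hhm := measurable_fracInt (α := α) (b := b) hg'
  have hh : ∀ x ∈ Icc a b, |fracInt α b g' x| ≤ G * ((b - a) ^ α / α) := fun x hx =>
    abs_fracInt_le hα hGb hx.1 hx.2
  set c := ∫ z in Ioi (0 : ℝ), z ^ (α - 1) / (z + 1) with hc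
  set h := fracInt α b g' with hh_def
  have hbdd : ∀ {F : ℝ → ℝ}, IntervalIntegrable F volume a b →
      IntervalIntegrable (fun x => h x * F x) volume a b := by
    intro F hF
    rw [intervalIntegrable_iff_integrableOn_Ioc_of_le hab] at hF ⊢
    refine Integrable.bdd_mul (c := G * ((b - a) ^ α / α)) hF hhm.aestronglyMeasurable ?_
    filter_upwards [ae_restrict_mem measurableSet_Ioc] with x hx
    exact hh x (Ioc_subset_Icc_self hx)
  have hT : IntegrableOn (fun p : ℝ × ℝ => h p.1 * ((f p.1 - f p.2) / (p.1 - p.2) ^ (1 + α)))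
      (triangle a b) :=
    IntegrableOn.bdd_mul_triangle hG (by fun_prop) fun p hp =>
      hh p.1 ⟨(hp.1.trans hp.2.1).le, hp.2.2.le⟩
  have i1 := hbdd (intervalIntegrable_div_rpow hab hα1 hf)
  have i2 := hbdd ((intervalIntegrable_triangle_left hab hG).const_mul α)
  have e1 : ∫ x in a..b, leftCore α a f x * h x =
      (∫ x in a..b, h x * (f x / (x - a) ^ α)) +
      α * ∫ p in triangle a b, h p.1 * ((f p.1 - f p.2) / (p.1 - p.2) ^ (1 + α)) := by
    rw [integral_triangle_left hab hT, ← intervalIntegral.integral_const_mul,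
      ← intervalIntegral.integral_add i1]
    · refine intervalIntegral.integral_congr fun x _ => ?_
      simp only
      rw [intervalIntegral.integral_const_mul, leftCore]
      ring
    · refine i2.congr fun x _ => ?_
      simp only
      rw [intervalIntegral.integral_const_mul]
      ring
  -- Each regularized kernel is dominated by its value at `η = 0`, which is integrable by finiteness
  -- of the seminorm.
  have t1 : Tendsto (fun η => α * ∫ p in triangle a b,
      h p.1 * ((f p.1 - f p.2) * (p.1 - p.2 + η) ^ (-1 - α))) (𝓝[>] 0)
      (𝓝 (α * ∫ p in triangle a b, h p.1 * ((f p.1 - f p.2) / (p.1 - p.2) ^ (1 + α)))) := by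
    refine Tendsto.const_mul _ (tendsto_integral_filter_of_dominated_convergence
      (fun p => |h p.1 * ((f p.1 - f p.2) / (p.1 - p.2) ^ (1 + α))|)
      (Eventually.of_forall fun η => Measurable.aestronglyMeasurable (by fun_prop)) ?_ hT.abs ?_)
    · filter_upwards [self_mem_nhdsWithin] with η hη
      filter_upwards [ae_restrict_mem (measurableSet_triangle a b)] with p hp
      have hη' : 0 < η := hη
      have h0 : 0 < p.1 - p.2 := sub_pos.2 hp.2.1
      rw [Real.norm_eq_abs, abs_mul, abs_mul, abs_mul, div_eq_mul_inv, abs_mul,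
        ← Real.rpow_neg h0.le, abs_of_pos (Real.rpow_pos_of_pos h0 _),
        abs_of_pos (Real.rpow_pos_of_pos (by linarith : 0 < p.1 - p.2 + η) _),
        show -(1 + α) = -1 - α by ring]
      gcongr ?_ * (_ * ?_)
      exact Real.rpow_le_rpow_of_nonpos h0 (by linarith) (by linarith)
    · filter_upwards [ae_restrict_mem (measurableSet_triangle a b)] with p hp
      have h0 : 0 < p.1 - p.2 := sub_pos.2 hp.2.1
      have h1 : ContinuousAt (fun η : ℝ => h p.1 * ((f p.1 - f p.2) *
          (p.1 - p.2 + η) ^ (-1 - α))) 0 := by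
        refine continuousAt_const.mul (continuousAt_const.mul
          (ContinuousAt.rpow_const (by fun_prop) (Or.inl ?_)))
        linarith
      have h2 := h1.tendsto
      have h3 : (p.1 - p.2) ^ (-1 - α) = ((p.1 - p.2) ^ (1 + α))⁻¹ := by
        rw [← Real.rpow_neg h0.le]
        congr 1
        ring
      rw [add_zero, h3, ← div_eq_mul_inv] at h2
      exact h2.mono_left nhdsWithin_le_nhds
  have t2 : Tendsto (fun η => ∫ x in a..b, f x * h x * (x - a + η) ^ (-α)) (𝓝[>] 0)
      (𝓝 (∫ x in a..b, h x * (f x / (x - a) ^ α))) := by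
    refine intervalIntegral.tendsto_integral_filter_of_dominated_convergence
      (fun x => |h x * (f x / (x - a) ^ α)|)
      (Eventually.of_forall fun η => Measurable.aestronglyMeasurable (by fun_prop)) ?_ i1.abs ?_
    · filter_upwards [self_mem_nhdsWithin] with η hη
      refine Eventually.of_forall fun x hx => ?_
      rw [uIoc_of_le hab] at hx
      have hη' : 0 < η := hη
      have h0 : 0 < x - a := sub_pos.2 hx.1
      rw [Real.norm_eq_abs, abs_mul, abs_mul, abs_mul, div_eq_mul_inv, abs_mul,
        ← Real.rpow_neg h0.le, abs_of_pos (Real.rpow_pos_of_pos h0 _),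
        abs_of_pos (Real.rpow_pos_of_pos (by linarith : 0 < x - a + η) _),
        mul_comm |f x|, mul_assoc]
      gcongr ?_ * (_ * ?_)
      exact Real.rpow_le_rpow_of_nonpos h0 (by linarith) (by linarith)
    · refine Eventually.of_forall fun x hx => ?_
      rw [uIoc_of_le hab] at hx
      have h0 : 0 < x - a := sub_pos.2 hx.1
      have h1 : ContinuousAt (fun η : ℝ => f x * h x * (x - a + η) ^ (-α)) 0 := by
        refine continuousAt_const.mul (ContinuousAt.rpow_const (by fun_prop) (Or.inl ?_))
        linarith
      have h2 := h1.tendsto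
      have h3 : f x * h x * (x - a) ^ (-α) = h x * (f x / (x - a) ^ α) := by
        rw [Real.rpow_neg h0.le]
        ring
      rw [add_zero, h3] at h2
      exact h2.mono_left nhdsWithin_le_nhds
  have t3 : Tendsto (fun η => ∫ x in a..b, f x *
      ∫ v in x..b, g' v * ((v - x) ^ (α - 1) * η ^ (1 - α) / (v - x + η))) (𝓝[>] 0)
      (𝓝 (∫ x in a..b, f x * (g' x * c))) := by
    refine intervalIntegral.tendsto_integral_filter_of_dominated_convergence
      (fun x => |f x| * (G * c)) ?_ ?_ (by
        refine Continuous.intervalIntegrable (by fun_prop) _ _) ?_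
    · filter_upwards [self_mem_nhdsWithin] with η hη
      have hη' : 0 < η := hη
      have hF : IntegrableOn (fun p : ℝ × ℝ => (g' p.1 * (η ^ (1 - α) / (p.1 - p.2 + η))) *
          (p.1 - p.2) ^ (α - 1)) (triangle a b) := by
        have hgm := hg'.measurable
        refine IntegrableOn.bdd_mul_triangle (C := G * (η ^ (1 - α) / η))
          (integrableOn_triangle_rpow (by linarith) a b) (by fun_prop) fun p hp => ?_
        have h0 : 0 < p.1 - p.2 := sub_pos.2 hp.2.1
        have h1 := hGb p.1 ⟨(hp.1.trans hp.2.1).le, hp.2.2.le⟩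
        have h2 : 0 < η ^ (1 - α) := Real.rpow_pos_of_pos hη' _
        rw [abs_mul, abs_of_pos (div_pos h2 (by linarith : 0 < p.1 - p.2 + η))]
        refine mul_le_mul h1 ?_ (div_pos h2 (by linarith)).le ((norm_nonneg _).trans h1)
        gcongr
        linarith
      have hI := ((intervalIntegrable_iff_integrableOn_Ioc_of_le hab).1
        (intervalIntegrable_triangle_right hab hF)).aestronglyMeasurable
      rw [uIoc_of_le hab]
      refine AEStronglyMeasurable.mul hf.aestronglyMeasurable (hI.congr ?_)
      refine Eventually.of_forall fun x => ?_
      refine intervalIntegral.integral_congr fun v _ => ?_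
      simp only
      ring
    · filter_upwards [self_mem_nhdsWithin] with η hη
      refine Eventually.of_forall fun x hx => ?_
      rw [uIoc_of_le hab] at hx
      rw [norm_mul]
      refine mul_le_mul_of_nonneg_left ?_ (norm_nonneg _)
      exact abs_integral_approx_identity_le hα hα1 hη hx.2
        fun v hv => hGb v ⟨hx.1.le.trans hv.1, hv.2⟩
    · have : ∀ᵐ x : ℝ, x ≠ b := by simp [ae_iff]
      filter_upwards [this] with x hxb hx
      rw [uIoc_of_le hab] at hx
      exact (tendsto_integral_approx_identity hα hα1 (lt_of_le_of_ne hx.2 hxb) hg'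
        fun v hv => hGb v ⟨hx.1.le.trans hv.1, hv.2⟩).const_mul _
  -- Passing to the limit in the regularized identity expresses the seminorm part as `c ∫ f g'`
  -- minus exactly the boundary part of `e1`, so the boundary parts cancel.
  have t4 := tendsto_nhds_unique (t1.congr' (f₂ := fun η => (∫ x in a..b, f x *
      ∫ v in x..b, g' v * ((v - x) ^ (α - 1) * η ^ (1 - α) / (v - x + η))) -
      ∫ x in a..b, f x * h x * (x - a + η) ^ (-α)) ?_) (t3.sub t2)
  · rw [realGls_eq_neg hα hab hg hg', e1, t4]
    simp only [← mul_assoc]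
    rw [intervalIntegral.integral_mul_const]
    ring
  · filter_upwards [self_mem_nhdsWithin] with η hη
    exact regularized_integral_eq hα hη hab hf hg'

/-! ### Steklov averages and additivity of the integral -/

/-- The Steklov average `δ⁻¹ ∫_x^{x+δ} g`. -/
noncomputable def steklov (g : ℝ → ℝ) (δ x : ℝ) : ℝ :=
  δ⁻¹ * ((∫ u in (0 : ℝ)..x + δ, g u) - ∫ u in (0 : ℝ)..x, g u)

lemma hasDerivAt_steklov {g : ℝ → ℝ} (hg : Continuous g) (δ x : ℝ) :
    HasDerivAt (steklov g δ) (δ⁻¹ * (g (x + δ) - g x)) x := by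
  have h : ∀ y, HasDerivAt (fun t => ∫ u in (0 : ℝ)..t, g u) (g y) y := fun y =>
    hg.integral_hasStrictDerivAt 0 y |>.hasDerivAt
  exact (((h (x + δ)).comp_add_const x δ).sub (h x)).const_mul δ⁻¹

lemma steklov_eq {g : ℝ → ℝ} (hg : Continuous g) (δ x : ℝ) :
    steklov g δ x = δ⁻¹ * ∫ u in (0 : ℝ)..δ, g (x + u) := by
  rw [steklov, intervalIntegral.integral_interval_sub_left (hg.intervalIntegrable _ _)
    (hg.intervalIntegrable _ _), intervalIntegral.integral_comp_add_left, add_zero]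

lemma continuous_steklov {g : ℝ → ℝ} (hg : Continuous g) (δ : ℝ) : Continuous (steklov g δ) :=
  continuous_iff_continuousAt.2 fun x => (hasDerivAt_steklov hg δ x).continuousAt

/-- Averaging translates preserves the Hölder constant. The window looks ahead by `δ ≤ 1`, hence the
extra unit `B + 1` here and in every later hypothesis on the integrator. -/
lemma HolderBound.steklov {M β A B δ : ℝ} {g : ℝ → ℝ} (hg : Continuous g)
    (h : HolderBound M β A (B + 1) g) (hδ : 0 < δ) (hδ1 : δ ≤ 1) :
    HolderBound M β A B (steklov g δ) := by
  intro x y hx hxy hy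
  rw [steklov_eq hg, steklov_eq hg, ← mul_sub, ← intervalIntegral.integral_sub
    (Continuous.intervalIntegrable (by fun_prop) _ _)
    (Continuous.intervalIntegrable (by fun_prop) _ _), abs_mul, abs_of_pos (inv_pos.2 hδ)]
  have h1 : ‖∫ u in (0 : ℝ)..δ, g (y + u) - g (x + u)‖ ≤ M * (y - x) ^ β * |δ - 0| := by
    refine intervalIntegral.norm_integral_le_of_norm_le_const fun u hu => ?_
    rw [uIoc_of_le hδ.le] at hu
    have := h (x + u) (y + u) (by linarith [hu.1]) (by linarith) (by linarith [hu.2])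
    rwa [add_sub_add_right_eq_sub] at this
  rw [sub_zero, abs_of_pos hδ, Real.norm_eq_abs] at h1
  calc _ ≤ δ⁻¹ * (M * (y - x) ^ β * δ) := by gcongr
    _ = _ := by field_simp

lemma tendsto_steklov {g : ℝ → ℝ} (hg : Continuous g) (x : ℝ) :
    Tendsto (fun n : ℕ => steklov g (1 / ((n : ℝ) + 1)) x) atTop (𝓝 (g x)) := by
  have h := (hg.integral_hasStrictDerivAt 0 x).hasDerivAt.tendsto_slope_zero_right
  have h1 : Tendsto (fun n : ℕ => 1 / ((n : ℝ) + 1)) atTop (𝓝[>] 0) := by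
    refine tendsto_nhdsWithin_iff.2 ⟨tendsto_one_div_add_atTop_nhds_zero_nat, ?_⟩
    exact Eventually.of_forall fun n => by simp only [mem_Ioi]; positivity
  exact h.comp h1

/-- The derivative of the Steklov average. -/
noncomputable def steklovDeriv (g : ℝ → ℝ) (n : ℕ) (x : ℝ) : ℝ :=
  (1 / ((n : ℝ) + 1))⁻¹ * (g (x + 1 / ((n : ℝ) + 1)) - g x)

lemma continuous_steklovDeriv {g : ℝ → ℝ} (hg : Continuous g) (n : ℕ) :
    Continuous (steklovDeriv g n) := by
  unfold steklovDeriv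
  fun_prop

/-- The constant relating `realGls` to the usual integral for smooth integrators. -/
noncomputable def glsConst (α : ℝ) : ℝ := -∫ z in Ioi (0 : ℝ), z ^ (α - 1) / (z + 1)

lemma tendsto_integral_steklovDeriv {α β a b M : ℝ} (hα : 0 < α) (hα1 : α < 1)
    (hαβ : 1 < α + β) (hM : 0 ≤ M) (hab : a ≤ b) {f g : ℝ → ℝ} (hf : Continuous f)
    (hG : GagliardoFinite α f a b) (hg : Continuous g) (hgH : HolderBound M β a (b + 1) g) :
    Tendsto (fun n => glsConst α * ∫ x in a..b, f x * steklovDeriv g n x) atTop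
      (𝓝 (realGls α a b f g)) := by
  have h1 : ∀ n : ℕ, 0 < 1 / ((n : ℝ) + 1) := fun n => by positivity
  have h2 : ∀ n : ℕ, 1 / ((n : ℝ) + 1) ≤ 1 := fun n => by
    rw [div_le_one (by positivity)]
    linarith [n.cast_nonneg (α := ℝ)]
  refine (tendsto_realGls hab hα1 hαβ hM hf hG
    (fun n => hgH.steklov hg (h1 n) (h2 n)) (fun n => continuous_steklov hg _)
    (tendsto_steklov hg)).congr fun n => ?_
  exact realGls_of_hasDerivAt hα hα1 hab hf hG (fun y => hasDerivAt_steklov hg _ y)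
    (continuous_steklovDeriv hg n)

/-- Not visible from the definition, where the base points of both derivatives change with the
interval; it is inherited from ordinary integrals in the limit. -/
theorem realGls_add {α β a m b M : ℝ} (hα : 0 < α) (hα1 : α < 1)
    (hαβ : 1 < α + β) (hM : 0 ≤ M) (ham : a ≤ m) (hmb : m ≤ b) {f g : ℝ → ℝ} (hf : Continuous f)
    (hG : GagliardoFinite α f a b) (hg : Continuous g) (hgH : HolderBound M β a (b + 1) g) :
    realGls α a m f g + realGls α m b f g = realGls α a b f g := by
  have t1 := tendsto_integral_steklovDeriv hα hα1 hαβ hM ham hf (hG.mono le_rfl hmb) hg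
    (hgH.mono le_rfl (by linarith))
  have t2 := tendsto_integral_steklovDeriv hα hα1 hαβ hM hmb hf (hG.mono ham le_rfl) hg
    (hgH.mono ham le_rfl)
  have t3 := tendsto_integral_steklovDeriv hα hα1 hαβ hM (ham.trans hmb) hf hG hg hgH
  refine tendsto_nhds_unique (t1.add t2) (t3.congr fun n => ?_)
  have hc : Continuous fun x => f x * steklovDeriv g n x := hf.mul (continuous_steklovDeriv hg n)
  rw [← mul_add, intervalIntegral.integral_add_adjacent_intervals
    (hc.intervalIntegrable _ _) (hc.intervalIntegrable _ _)]

/-! ### Sewing and the Young-Loeve estimate -/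

/-- A midpoint version of the sewing lemma. -/
lemma sewing_bound {A B θ : ℝ} (hθ1 : θ < 1) {R W : ℝ → ℝ → ℝ}
    (hR : ∀ u v, A ≤ u → u ≤ v → v ≤ B →
      |R u v| ≤ |R u ((u + v) / 2)| + |R ((u + v) / 2) v| + W u v)
    (hW : ∀ u v, A ≤ u → u ≤ v → v ≤ B →
      W u ((u + v) / 2) + W ((u + v) / 2) v ≤ θ * W u v)
    (hW0 : ∀ u v, A ≤ u → u ≤ v → v ≤ B → 0 ≤ W u v)
    (hsmall : ∀ δ > 0, ∃ τ > 0, ∀ u v, A ≤ u → u ≤ v → v ≤ B → v - u ≤ τ →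
      |R u v| ≤ δ * (v - u))
    {u v : ℝ} (hu : A ≤ u) (huv : u ≤ v) (hv : v ≤ B) : |R u v| ≤ W u v / (1 - θ) := by
  have h1θ : 0 < 1 - θ := by linarith
  refine le_of_forall_pos_le_add fun e he => ?_
  obtain ⟨τ, hτ, h⟩ := hsmall (e / (v - u + 1)) (by apply div_pos he; linarith)
  set δ := e / (v - u + 1) with hδ
  have hδ0 : 0 < δ := by
    apply div_pos he
    linarith
  -- The error `δ (v - u)` is additive under bisection, and `1 / (1 - θ)` solves `θ y + 1 = y`, so
  -- the bound reproduces itself when the length doubles.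
  have main : ∀ n : ℕ, ∀ u v, A ≤ u → u ≤ v → v ≤ B → v - u ≤ 2 ^ n * τ →
      |R u v| ≤ W u v / (1 - θ) + δ * (v - u) := by
    intro n
    induction n with
    | zero =>
      intro u v hu huv hv hd
      have := div_nonneg (hW0 u v hu huv hv) h1θ.le
      linarith [h u v hu huv hv (by simpa using hd)]
    | succ n ih =>
      intro u v hu huv hv hd
      rw [pow_succ] at hd
      have a1 := ih u ((u + v) / 2) hu (by linarith) (by linarith) (by linarith)
      have a2 := ih ((u + v) / 2) v (by linarith) (by linarith) hv (by linarith)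
      have a3 := hR u v hu huv hv
      have a4 : (W u ((u + v) / 2) + W ((u + v) / 2) v) / (1 - θ) ≤ θ * W u v / (1 - θ) :=
        div_le_div_of_nonneg_right (hW u v hu huv hv) h1θ.le
      have a5 : θ * W u v / (1 - θ) + W u v = W u v / (1 - θ) := by
        field_simp
        ring
      rw [add_div] at a4
      linarith
  obtain ⟨n, hn⟩ := pow_unbounded_of_one_lt ((v - u) / τ) (one_lt_two (α := ℝ))
  have := main n u v hu huv hv ((div_le_iff₀ hτ).1 hn.le)
  have h2 : δ * (v - u) ≤ e := by
    rw [hδ, div_mul_eq_mul_div, div_le_iff₀ (by linarith)]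
    nlinarith
  linarith

lemma integral_sewing_bound {A B M β θ : ℝ} (hθ1 : θ < 1) {f g g' : ℝ → ℝ}
    {W : ℝ → ℝ → ℝ} (hf : Continuous f) (hg : ∀ y, HasDerivAt g (g' y) y) (hg' : Continuous g')
    (hgH : HolderBound M β A B g)
    (hfW : ∀ u v, A ≤ u → u ≤ v → v ≤ B →
      |f ((u + v) / 2) - f u| * (M * (v - (u + v) / 2) ^ β) ≤ W u v)
    (hW : ∀ u v, A ≤ u → u ≤ v → v ≤ B →
      W u ((u + v) / 2) + W ((u + v) / 2) v ≤ θ * W u v)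
    (hW0 : ∀ u v, A ≤ u → u ≤ v → v ≤ B → 0 ≤ W u v)
    {s t : ℝ} (hs : A ≤ s) (hst : s ≤ t) (ht : t ≤ B) :
    |(∫ x in s..t, f x * g' x) - f s * (g t - g s)| ≤ W s t / (1 - θ) := by
  have hi : ∀ u v, ∫ x in u..v, g' x = g v - g u := fun u v =>
    intervalIntegral.integral_eq_sub_of_hasDerivAt (fun y _ => hg y)
      (hg'.intervalIntegrable _ _)
  have hfg : Continuous fun x => f x * g' x := hf.mul hg'
  set R : ℝ → ℝ → ℝ := fun u v => (∫ x in u..v, f x * g' x) - f u * (g v - g u) with hRdef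
  refine sewing_bound (R := R) hθ1 (fun u v hu huv hv => ?_) hW hW0 ?_ hs hst ht
  -- The failure of additivity of the Riemann-sum error is a product of two increments, and involves
  -- `g` only through its Hölder constant.
  · have h1 : R u v = R u ((u + v) / 2) + R ((u + v) / 2) v +
        (f ((u + v) / 2) - f u) * (g v - g ((u + v) / 2)) := by
      simp only [hRdef]
      rw [← intervalIntegral.integral_add_adjacent_intervals (hfg.intervalIntegrable u ((u+v)/2))
        (hfg.intervalIntegrable ((u+v)/2) v)]
      ring
    rw [h1]
    refine (abs_add_le _ _).trans (add_le_add (abs_add_le _ _) ?_)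
    rw [abs_mul]
    refine le_trans ?_ (hfW u v hu huv hv)
    gcongr
    exact hgH _ _ (by linarith) (by linarith) hv
  · intro δ hδ
    obtain ⟨G, hG⟩ := (isCompact_Icc (a := A) (b := B)).exists_bound_of_continuousOn
      hg'.continuousOn
    have huc := (isCompact_Icc (a := A) (b := B)).uniformContinuousOn_of_continuous
      hf.continuousOn
    rw [Metric.uniformContinuousOn_iff_le] at huc
    obtain ⟨τ, hτ, h⟩ := huc (δ / (|G| + 1)) (by positivity)
    refine ⟨τ, hτ, fun u v hu huv hv hd => ?_⟩
    have h1 : R u v = ∫ x in u..v, (f x - f u) * g' x := by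
      simp only [hRdef, sub_mul]
      have hc : Continuous fun x => f u * g' x := continuous_const.mul hg'
      rw [intervalIntegral.integral_sub (hfg.intervalIntegrable _ _) (hc.intervalIntegrable _ _),
        intervalIntegral.integral_const_mul, hi]
    rw [h1, ← Real.norm_eq_abs, ← abs_of_nonneg (sub_nonneg.2 huv)]
    refine intervalIntegral.norm_integral_le_of_norm_le_const fun x hx => ?_
    rw [uIoc_of_le huv] at hx
    have hx' : x ∈ Icc A B := ⟨hu.trans hx.1.le, hx.2.trans hv⟩
    rw [norm_mul]
    have b1 : ‖f x - f u‖ ≤ δ / (|G| + 1) := by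
      have := h x hx' u ⟨hu, huv.trans hv⟩
        (by rw [Real.dist_eq, abs_of_pos (sub_pos.2 hx.1)]; linarith [hx.2])
      rwa [Real.dist_eq] at this
    have b2 : ‖g' x‖ ≤ |G| + 1 := (hG x hx').trans ((le_abs_self G).trans (by linarith))
    calc _ ≤ δ / (|G| + 1) * (|G| + 1) := by gcongr
      _ = δ := by field_simp

/-- The contraction factor in the sewing argument. -/
noncomputable def sewingFactor (α β : ℝ) : ℝ :=
  max (2 * (1 / 2 : ℝ) ^ (2 * β)) ((1 / 2 : ℝ) ^ (α + 2 * β - 1))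

lemma sewingFactor_lt_one {α β : ℝ} (hβ : 1 / 2 < β) (hαβ : 1 < α + β) :
    sewingFactor α β < 1 := by
  refine max_lt ?_ ?_
  · have : (1 / 2 : ℝ) ^ (2 * β) < (1 / 2 : ℝ) ^ (1 : ℝ) :=
      Real.rpow_lt_rpow_of_exponent_gt (by norm_num) (by norm_num) (by linarith)
    rw [Real.rpow_one] at this
    linarith
  · exact Real.rpow_lt_one (by norm_num) (by norm_num) (by linarith)

/-- A Young-Loeve estimate for the generalized Lebesgue-Stieltjes integral. -/
theorem abs_realGls_le_of_increments {α β A B M P Q : ℝ} (hα : 0 < α) (hα1 : α < 1)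
    (hβ : 1 / 2 < β) (hαβ : 1 < α + β) (hM : 0 ≤ M) (hP : 0 ≤ P) (hQ : 0 ≤ Q)
    {f g : ℝ → ℝ} (hf : Continuous f)
    (hG : GagliardoFinite α f A B) (hg : Continuous g) (hgH : HolderBound M β A (B + 1) g)
    (hfi : ∀ s t, A ≤ s → s ≤ t → t ≤ B →
      |f t - f s| ≤ P * (t - s) ^ β + Q * (t - s) ^ (α + β - 1) * gagliardo α f s t)
    {s t : ℝ} (hs : A ≤ s) (hst : s ≤ t) (ht : t ≤ B) :
    |realGls α s t f g| ≤ |glsConst α| * (|f s| * (M * (t - s) ^ β)) +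
      |glsConst α| * (M * (P * (t - s) ^ (2 * β) +
        Q * (t - s) ^ (α + 2 * β - 1) * gagliardo α f s t) / (1 - sewingFactor α β)) := by
  set W : ℝ → ℝ → ℝ := fun u v => M * (P * (v - u) ^ (2 * β) +
    Q * (v - u) ^ (α + 2 * β - 1) * gagliardo α f u v) with hWdef
  have hθ1 := sewingFactor_lt_one hβ hαβ
  have hW0 : ∀ u v, A ≤ u → u ≤ v → v ≤ B → 0 ≤ W u v := by
    intro u v _ huv _
    have h0 : 0 ≤ v - u := by linarith
    have := gagliardo_nonneg α f u v
    simp only [hWdef]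
    positivity
  have hW : ∀ u v, A ≤ u → u ≤ v → v ≤ B →
      W u ((u + v) / 2) + W ((u + v) / 2) v ≤ sewingFactor α β * W u v := by
    intro u v hu huv hv
    have h0 : 0 ≤ v - u := by linarith
    have e1 : (u + v) / 2 - u = (1 / 2) * (v - u) := by ring
    have e2 : v - (u + v) / 2 = (1 / 2) * (v - u) := by ring
    -- The seminorm is merely superadditive; the contraction of its term comes from the positive
    -- power `α + 2β - 1` of the length. The other term contracts because `2β > 1`.
    have hφ := gagliardo_add_le (hG.mono hu hv) (by linarith : u ≤ (u + v) / 2) (by linarith)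
    have hφ0 := gagliardo_nonneg α f u v
    simp only [hWdef, e1, e2]
    rw [Real.mul_rpow (by norm_num) h0, Real.mul_rpow (by norm_num) h0]
    calc _ = M * (P * (v - u) ^ (2 * β) * (2 * (1 / 2 : ℝ) ^ (2 * β)) +
          Q * (v - u) ^ (α + 2 * β - 1) * (1 / 2 : ℝ) ^ (α + 2 * β - 1) *
          (gagliardo α f u ((u + v) / 2) + gagliardo α f ((u + v) / 2) v)) := by ring
      _ ≤ M * (P * (v - u) ^ (2 * β) * sewingFactor α β +
          Q * (v - u) ^ (α + 2 * β - 1) * sewingFactor α β * gagliardo α f u v) := by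
          have c1 : 2 * (1 / 2 : ℝ) ^ (2 * β) ≤ sewingFactor α β := le_max_left _ _
          have c2 : (1 / 2 : ℝ) ^ (α + 2 * β - 1) ≤ sewingFactor α β := le_max_right _ _
          have c3 : 0 ≤ sewingFactor α β := le_trans (by positivity) c2
          have c4 := gagliardo_nonneg α f u ((u + v) / 2)
          have c5 := gagliardo_nonneg α f ((u + v) / 2) v
          gcongr
      _ = _ := by ring
  have hfW : ∀ u v, A ≤ u → u ≤ v → v ≤ B →
      |f ((u + v) / 2) - f u| * (M * (v - (u + v) / 2) ^ β) ≤ W u v := by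
    intro u v hu huv hv
    rcases huv.eq_or_lt with rfl | huv
    · rw [show (u + u) / 2 = u by ring, sub_self, abs_zero, zero_mul]
      exact hW0 u u hu le_rfl hv
    have h0 : 0 < v - u := by linarith
    have h1 := hfi u ((u + v) / 2) hu (by linarith) (by linarith)
    have h2 : |f ((u + v) / 2) - f u| ≤ P * (v - u) ^ β +
        Q * (v - u) ^ (α + β - 1) * gagliardo α f u v := by
      refine h1.trans ?_
      have e1 : (u + v) / 2 - u ≤ v - u := by linarith
      have e2 : 0 ≤ (u + v) / 2 - u := by linarith
      have e3 := gagliardo_mono (hG.mono hu hv) le_rfl (by linarith : (u + v) / 2 ≤ v)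
      have e4 := gagliardo_nonneg α f u ((u + v) / 2)
      gcongr
    have h3 : (v - (u + v) / 2) ^ β ≤ (v - u) ^ β :=
      Real.rpow_le_rpow (by linarith) (by linarith) (by linarith)
    have h4 : 0 ≤ (v - (u + v) / 2) ^ β := Real.rpow_nonneg (by linarith) _
    calc _ ≤ (P * (v - u) ^ β + Q * (v - u) ^ (α + β - 1) * gagliardo α f u v) *
          (M * (v - u) ^ β) := by
          refine mul_le_mul h2 (by gcongr) (by positivity) ((abs_nonneg _).trans h2)
      _ = _ := by
          simp only [hWdef]
          rw [show 2 * β = β + β by ring, show α + (β + β) - 1 = (α + β - 1) + β by ring,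
            Real.rpow_add h0, Real.rpow_add h0]
          ring
  have hn1 : ∀ n : ℕ, 0 < 1 / ((n : ℝ) + 1) := fun n => by positivity
  have hn2 : ∀ n : ℕ, 1 / ((n : ℝ) + 1) ≤ 1 := fun n => by
    rw [div_le_one (by positivity)]
    linarith [n.cast_nonneg (α := ℝ)]
  -- Sewing is applied to the smooth averages; the bound is uniform in `n` and survives the limit.
  have key : ∀ n : ℕ, |(∫ x in s..t, f x * steklovDeriv g n x) -
      f s * (steklov g (1 / ((n : ℝ) + 1)) t - steklov g (1 / ((n : ℝ) + 1)) s)| ≤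
      W s t / (1 - sewingFactor α β) := fun n =>
    integral_sewing_bound hθ1 hf (fun y => hasDerivAt_steklov hg _ y)
      (continuous_steklovDeriv hg n) (hgH.steklov hg (hn1 n) (hn2 n)) hfW hW hW0 hs hst ht
  have lim := ((tendsto_integral_steklovDeriv hα hα1 hαβ hM hst hf (hG.mono hs ht) hg
    (hgH.mono hs (by linarith))).sub (((((tendsto_steklov hg t).sub (tendsto_steklov hg s))).const_mul
    (f s)).const_mul (glsConst α))).abs
  have h1 : |realGls α s t f g - glsConst α * (f s * (g t - g s))| ≤
      |glsConst α| * (W s t / (1 - sewingFactor α β)) := by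
    refine le_of_tendsto lim (Eventually.of_forall fun n => ?_)
    rw [← mul_sub, abs_mul]
    exact mul_le_mul_of_nonneg_left (key n) (abs_nonneg _)
  have h2 : |glsConst α * (f s * (g t - g s))| ≤ |glsConst α| * (|f s| * (M * (t - s) ^ β)) := by
    rw [abs_mul, abs_mul]
    gcongr
    exact hgH s t hs hst (by linarith)
  have h3 := abs_add_le (glsConst α * (f s * (g t - g s)))
    (realGls α s t f g - glsConst α * (f s * (g t - g s)))
  rw [add_sub_cancel] at h3
  exact h3.trans (add_le_add h2 h1)

/-! ### Growth of controlled paths -/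

/-- The increments of `x` on `[S, T]` are controlled by a generalized Lebesgue-Stieltjes integral
of `f` with respect to the Hölder function `g`, where `f` is a bounded Lipschitz function
of `x`. -/
structure ControlledPath (α β K L k M S T : ℝ) (x f g : ℝ → ℝ) : Prop where
  f_cont : Continuous f
  f_bdd : ∀ u, |f u| ≤ K
  f_lip : ∀ u v, |f u - f v| ≤ L * |x u - x v|
  gagliardoFinite : GagliardoFinite α f S T
  g_cont : Continuous g
  g_holder : HolderBound M β S (T + 1) g
  incr : ∀ s t, S ≤ s → s ≤ t → t ≤ T → |x t - x s| ≤ K * (t - s) + k * |realGls α s t f g|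

section

variable {α β K L k M S T : ℝ} {x f g : ℝ → ℝ}

lemma ControlledPath.mono {S' T' : ℝ} (h : ControlledPath α β K L k M S T x f g) (hS : S ≤ S')
    (hT : T' ≤ T) : ControlledPath α β K L k M S' T' x f g where
  f_cont := h.f_cont
  f_bdd := h.f_bdd
  f_lip := h.f_lip
  gagliardoFinite := h.gagliardoFinite.mono hS hT
  g_cont := h.g_cont
  g_holder := h.g_holder.mono hS (by linarith)
  incr := fun s t hs hst ht => h.incr s t (hS.trans hs) hst (ht.trans hT)

lemma rpow_le_rpow_of_le_one {r p q : ℝ} (h0 : 0 ≤ r) (h1 : r ≤ 1) (hq : 0 ≤ q) (hqp : q ≤ p) :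
    r ^ p ≤ r ^ q :=
  Real.rpow_le_rpow_of_exponent_ge_of_imp h0 h1 hqp fun _ hp => by linarith

/-- The crude bound `abs_realGls_le` already has the form required by the sewing estimate, since
`(α+β-1) + (1-α) = β`. -/
lemma ControlledPath.f_increment_le (h : ControlledPath α β K L k M S T x f g)
    (hα : 0 < α) (hα1 : α < 1) (hβ1 : β < 1) (hβ : 0 < β) (hαβ : 1 < α + β) (hK : 0 ≤ K)
    (hL : 0 ≤ L) (hk : 0 ≤ k) (hM : 0 ≤ M) (hST : T - S ≤ 1) :
    ∃ P Q : ℝ, 0 ≤ P ∧ 0 ≤ Q ∧ ∀ s t, S ≤ s → s ≤ t → t ≤ T →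
      |f t - f s| ≤ P * (t - s) ^ β + Q * (t - s) ^ (α + β - 1) * gagliardo α f s t := by
  have h1α : 0 < 1 - α := by linarith
  have hε : 0 < α + β - 1 := by linarith
  set C := M * (1 + (1 - α) / (α + β - 1)) with hC
  have hC0 : 0 ≤ C := by positivity
  refine ⟨L * (K + k * (C * (K / (1 - α)))), L * (k * (C * α)), by positivity, by positivity,
    fun s t hs hst ht => ?_⟩
  have h0 : 0 ≤ t - s := by linarith
  have h1 := abs_realGls_le hst hα hα1 hαβ hM h.f_cont h.f_bdd (h.gagliardoFinite.mono hs ht)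
    (h.g_holder.mono hs (by linarith))
  have h2 : t - s ≤ (t - s) ^ β := by
    have := rpow_le_rpow_of_le_one h0 (by linarith) hβ.le hβ1.le
    rwa [Real.rpow_one] at this
  have h3 : (t - s) ^ β = (t - s) ^ (α + β - 1) * (t - s) ^ (1 - α) := by
    rw [← Real.rpow_add_of_nonneg h0 hε.le h1α.le]
    congr 1
    ring
  rw [← hC] at h1
  calc |f t - f s| ≤ L * |x t - x s| := h.f_lip t s
    _ ≤ L * (K * (t - s) ^ β + k * (C * (t - s) ^ (α + β - 1) *
        (K * ((t - s) ^ (1 - α) / (1 - α)) + α * gagliardo α f s t))) := by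
        gcongr
        refine (h.incr s t hs hst ht).trans ?_
        gcongr
    _ = _ := by
        rw [h3]
        ring

/-- One application of the sewing estimate upgrades a finite seminorm to Hölder continuity. The
constant depends on the seminorm and is therefore useless quantitatively; only its finiteness
matters next. -/
lemma ControlledPath.exists_holderBound (h : ControlledPath α β K L k M S T x f g)
    (hα : 0 < α) (hα1 : α < 1) (hβ1 : β < 1) (hβ : 1 / 2 < β) (hαβ : 1 < α + β) (hK : 0 ≤ K)
    (hL : 0 ≤ L) (hk : 0 ≤ k) (hM : 0 ≤ M) (hST : T - S ≤ 1) :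
    ∃ N : ℝ, 0 ≤ N ∧ HolderBound N β S T x := by
  obtain ⟨P, Q, hP, hQ, hfi⟩ := h.f_increment_le hα hα1 hβ1 (by linarith) hαβ hK hL hk hM hST
  have hθ := sub_pos.2 (sewingFactor_lt_one hβ hαβ)
  have hφ0 := gagliardo_nonneg α f S T
  refine ⟨K + k * (|glsConst α| * (K * M) + |glsConst α| *
    (M * (P + Q * gagliardo α f S T) / (1 - sewingFactor α β))), by positivity,
    fun s t hs hst ht => ?_⟩
  have h0 : 0 ≤ t - s := by linarith
  have h1 : t - s ≤ 1 := by linarith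
  have a1 : t - s ≤ (t - s) ^ β := by
    have := rpow_le_rpow_of_le_one h0 h1 (by linarith) hβ1.le
    rwa [Real.rpow_one] at this
  have a2 : (t - s) ^ (2 * β) ≤ (t - s) ^ β :=
    rpow_le_rpow_of_le_one h0 h1 (by linarith) (by linarith)
  have a3 : (t - s) ^ (α + 2 * β - 1) ≤ (t - s) ^ β :=
    rpow_le_rpow_of_le_one h0 h1 (by linarith) (by linarith)
  have a4 := gagliardo_mono h.gagliardoFinite hs ht
  have a5 := gagliardo_nonneg α f s t
  have y := abs_realGls_le_of_increments hα hα1 hβ hαβ hM hP hQ h.f_cont h.gagliardoFinite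
    h.g_cont h.g_holder hfi hs hst ht
  calc |x t - x s| ≤ K * (t - s) + k * |realGls α s t f g| := h.incr s t hs hst ht
    _ ≤ K * (t - s) ^ β + k * (|glsConst α| * (K * (M * (t - s) ^ β)) +
      |glsConst α| * (M * (P * (t - s) ^ β +
        Q * (t - s) ^ β * gagliardo α f S T) / (1 - sewingFactor α β))) := by
        gcongr
        refine y.trans ?_
        have := h.f_bdd s
        gcongr
    _ = _ := by ring

/-- With a Hölder constant `N` for `x`, sewing with `P = L N` and `Q = 0` yields the constant `D + N
/ 2`. Iterating from the finite constant above forgets it and converges to `2 D`. -/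
lemma ControlledPath.holderBound_of_small (h : ControlledPath α β K L k M S T x f g)
    (hα : 0 < α) (hα1 : α < 1) (hβ1 : β < 1) (hβ : 1 / 2 < β) (hαβ : 1 < α + β) (hK : 0 ≤ K)
    (hL : 0 ≤ L) (hk : 0 ≤ k) (hM : 0 ≤ M) (hST : T - S ≤ 1)
    (hsmall : k * |glsConst α| * L / (1 - sewingFactor α β) * M * (T - S) ^ β ≤ 1 / 2) :
    HolderBound (2 * (K + k * |glsConst α| * K * M)) β S T x := by
  have hθ := sub_pos.2 (sewingFactor_lt_one hβ hαβ)
  set D := K + k * |glsConst α| * K * M with hD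
  have step : ∀ N, 0 ≤ N → HolderBound N β S T x → HolderBound (D + N / 2) β S T x := by
    intro N hN hx s t hs hst ht
    have h0 : 0 ≤ t - s := by linarith
    have h1 : t - s ≤ 1 := by linarith
    have a1 : t - s ≤ (t - s) ^ β := by
      have := rpow_le_rpow_of_le_one h0 h1 (by linarith) hβ1.le
      rwa [Real.rpow_one] at this
    have a2 : (t - s) ^ (2 * β) = (t - s) ^ β * (t - s) ^ β := by
      rw [← Real.rpow_add_of_nonneg h0 (by linarith) (by linarith), two_mul]
    have a3 : (t - s) ^ β ≤ (T - S) ^ β :=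
      Real.rpow_le_rpow h0 (by linarith) (by linarith)
    have y := abs_realGls_le_of_increments (P := L * N) (Q := 0) hα hα1 hβ hαβ hM
      (by positivity) le_rfl h.f_cont h.gagliardoFinite h.g_cont h.g_holder
      (fun u v hu huv hv => by
        have := (h.f_lip v u).trans (mul_le_mul_of_nonneg_left (hx u v hu huv hv) hL)
        linarith) hs hst ht
    have a4 : 0 ≤ (t - s) ^ β := Real.rpow_nonneg h0 _
    calc |x t - x s| ≤ K * (t - s) + k * |realGls α s t f g| := h.incr s t hs hst ht
      _ ≤ K * (t - s) ^ β + k * (|glsConst α| * (K * (M * (t - s) ^ β)) +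
        |glsConst α| * (M * (L * N * (t - s) ^ (2 * β) +
          0 * (t - s) ^ (α + 2 * β - 1) * gagliardo α f s t) / (1 - sewingFactor α β))) := by
          gcongr
          refine y.trans ?_
          have := h.f_bdd s
          gcongr
      _ = D * (t - s) ^ β + (k * |glsConst α| * L / (1 - sewingFactor α β) * M * (t - s) ^ β) *
          (N * (t - s) ^ β) := by
          rw [a2, hD]
          ring
      _ ≤ D * (t - s) ^ β + (1 / 2) * (N * (t - s) ^ β) := by
          gcongr
          exact le_trans (by gcongr) hsmall
      _ = _ := by ring
  obtain ⟨N, hN, hx⟩ := h.exists_holderBound hα hα1 hβ1 hβ hαβ hK hL hk hM hST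
  have hD0 : 0 ≤ D := by positivity
  have iter : ∀ n : ℕ, HolderBound (2 * D + N * (1 / 2) ^ n) β S T x := by
    intro n
    induction n with
    | zero =>
      intro s t hs hst ht
      refine (hx s t hs hst ht).trans ?_
      have : 0 ≤ (t - s) ^ β := Real.rpow_nonneg (by linarith) _
      gcongr
      simp only [pow_zero, mul_one]
      linarith
    | succ n ih =>
      have := step _ (by positivity) ih
      convert this using 1
      rw [pow_succ]
      ring
  intro s t hs hst ht
  have lim : Tendsto (fun n : ℕ => (2 * D + N * (1 / 2 : ℝ) ^ n) * (t - s) ^ β) atTop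
      (𝓝 ((2 * D + N * 0) * (t - s) ^ β)) :=
    ((tendsto_const_nhds.add ((tendsto_pow_atTop_nhds_zero_of_lt_one (by norm_num)
      (by norm_num)).const_mul N)).mul_const _)
  rw [mul_zero, add_zero] at lim
  exact ge_of_tendsto lim (Eventually.of_forall fun n => iter n s t hs hst ht)

lemma abs_sub_le_of_steps {y : ℝ → ℝ} {s ℓ c : ℝ} (p : ℕ)
    (h : ∀ i : ℕ, i < p → |y (s + (i + 1) * ℓ) - y (s + i * ℓ)| ≤ c) :
    |y (s + p * ℓ) - y s| ≤ p * c := by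
  induction p with
  | zero => simp
  | succ p ih =>
    have h1 := ih fun i hi => h i (hi.trans (Nat.lt_succ_self p))
    have h2 := h p (Nat.lt_succ_self p)
    have h3 := abs_add_le (y (s + (p + 1) * ℓ) - y (s + p * ℓ)) (y (s + p * ℓ) - y s)
    rw [sub_add_sub_cancel] at h3
    push_cast
    linarith

/-- The growth bound for controlled paths on intervals of length at most one. -/
theorem exists_controlledPath_bound (hα : 0 < α) (hα1 : α < 1) (hβ1 : β < 1) (hβ : 1 / 2 < β)
    (hαβ : 1 < α + β) (hK : 0 ≤ K) (hL : 0 ≤ L) (hk : 0 ≤ k) :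
    ∃ C : ℝ, 0 ≤ C ∧ ∀ (M S T : ℝ) (x f g : ℝ → ℝ), 0 ≤ M → S ≤ T → T - S ≤ 1 →
      ControlledPath α β K L k M S T x f g →
      |x T - x S| ≤ C * (1 + M) ^ (1 / β) * (T - S) ^ β := by
  have hθ := sub_pos.2 (sewingFactor_lt_one hβ hαβ)
  have hβ0 : 0 < β := by linarith
  set C2 := k * |glsConst α| * L / (1 - sewingFactor α β) with hC2
  have hC20 : 0 ≤ C2 := by positivity
  set C1 := 2 * (K + k * |glsConst α| * K) with hC1
  have hC10 : 0 ≤ C1 := by positivity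
  -- The `2` absorbs the rounding up and the added `1` in `p` below, using `1 ≤ (1 + M)^(1/β)`.
  set C3 := (2 * C2) ^ (1 / β) + 2 with hC3
  have hC30 : 0 ≤ C3 := by positivity
  refine ⟨C3 ^ (1 - β) * C1, by positivity, fun M S T x f g hM hST hST1 h => ?_⟩
  -- Enough equal pieces for the smallness condition on each of them; the added `1` keeps `p`
  -- positive when `M = 0`.
  set p : ℕ := ⌈(2 * C2 * M) ^ (1 / β)⌉₊ + 1 with hp
  have hp1 : (2 * C2 * M) ^ (1 / β) ≤ p := by
    rw [hp]
    push_cast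
    linarith [Nat.le_ceil ((2 * C2 * M) ^ (1 / β))]
  have hp0 : (0 : ℝ) < p := by
    rw [hp]
    positivity
  have hM1 : 1 ≤ (1 + M) ^ (1 / β) := Real.one_le_rpow (by linarith) (by positivity)
  have hp2 : (p : ℝ) ≤ C3 * (1 + M) ^ (1 / β) := by
    have e1 : (2 * C2 * M) ^ (1 / β) ≤ (2 * C2) ^ (1 / β) * (1 + M) ^ (1 / β) := by
      rw [← Real.mul_rpow (by positivity) (by positivity)]
      gcongr
      linarith
    have e2 := (Nat.ceil_lt_add_one (a := (2 * C2 * M) ^ (1 / β)) (by positivity)).le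
    rw [hp, hC3]
    push_cast
    linarith
  set ℓ := (T - S) / p with hℓ
  have hℓ0 : 0 ≤ ℓ := div_nonneg (by linarith) hp0.le
  have hpℓ : p * ℓ = T - S := by
    rw [hℓ]
    field_simp
  have hℓ1 : ℓ ≤ 1 / p := by
    rw [hℓ]
    gcongr
  have hsm : C2 * M * ℓ ^ β ≤ 1 / 2 := by
    have e1 : ℓ ^ β ≤ (1 / p) ^ β := Real.rpow_le_rpow hℓ0 hℓ1 hβ0.le
    have e2 : 2 * C2 * M ≤ (p : ℝ) ^ β := by
      have := Real.rpow_le_rpow (by positivity) hp1 hβ0.le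
      rwa [← Real.rpow_mul (by positivity), one_div_mul_cancel hβ0.ne', Real.rpow_one] at this
    have e3 : (1 / (p : ℝ)) ^ β * (p : ℝ) ^ β = 1 := by
      rw [← Real.mul_rpow (by positivity) hp0.le, one_div_mul_cancel hp0.ne', Real.one_rpow]
    have e4 : 0 ≤ (1 / (p : ℝ)) ^ β := by positivity
    have e5 : C2 * M * ℓ ^ β ≤ C2 * M * (1 / (p : ℝ)) ^ β := by gcongr
    nlinarith
  have hstep : ∀ i : ℕ, i < p → |x (S + (i + 1) * ℓ) - x (S + i * ℓ)| ≤ C1 * (1 + M) * ℓ ^ β := by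
    intro i hi
    have hi1 : ((i : ℝ) + 1) * ℓ ≤ p * ℓ := by
      gcongr
      exact_mod_cast hi
    have hi0 : 0 ≤ (i : ℝ) * ℓ := by positivity
    have hd : S + (i + 1) * ℓ - (S + i * ℓ) = ℓ := by ring
    have hle : S + i * ℓ ≤ S + (i + 1) * ℓ := by linarith
    have := (h.mono (S' := S + i * ℓ) (T' := S + (i + 1) * ℓ) (by linarith)
      (by linarith)).holderBound_of_small hα hα1 hβ1 hβ hαβ hK hL hk hM
      (by rw [hd]; exact hℓ1.trans (by
            rw [div_le_one hp0, hp]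
            push_cast
            linarith [Nat.cast_nonneg (α := ℝ) ⌈(2 * C2 * M) ^ (1 / β)⌉₊]))
      (by rw [hd]; exact hsm) _ _ le_rfl hle le_rfl
    rw [hd] at this
    refine this.trans (mul_le_mul_of_nonneg_right ?_ (by positivity))
    rw [hC1]
    have : 0 ≤ K * M := by positivity
    have : 0 ≤ k * |glsConst α| * K := by positivity
    nlinarith
  have hfin := abs_sub_le_of_steps p hstep
  rw [hpℓ, add_sub_cancel] at hfin
  refine hfin.trans ?_
  have e1 : (p : ℝ) * ℓ ^ β = (p : ℝ) ^ (1 - β) * (T - S) ^ β := by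
    rw [hℓ, Real.div_rpow (by linarith) hp0.le, Real.rpow_sub hp0, Real.rpow_one]
    ring
  have e2 : (p : ℝ) ^ (1 - β) ≤ C3 ^ (1 - β) * ((1 + M) ^ (1 / β)) ^ (1 - β) := by
    rw [← Real.mul_rpow hC30 (by positivity)]
    exact Real.rpow_le_rpow hp0.le hp2 (by linarith)
  -- The `p` pieces contribute `p^(1-β) (1 + M)` in total, and `(1 - β)/β + 1 = 1/β`.
  have e3 : ((1 + M) ^ (1 / β)) ^ (1 - β) * (1 + M) = (1 + M) ^ (1 / β) := by
    rw [← Real.rpow_mul (by positivity), ← Real.rpow_add_one (by positivity)]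
    congr 1
    field_simp
    ring
  have hTS : 0 ≤ (T - S) ^ β := Real.rpow_nonneg (by linarith) _
  calc (p : ℝ) * (C1 * (1 + M) * ℓ ^ β) = (p : ℝ) * ℓ ^ β * (C1 * (1 + M)) := by ring
    _ ≤ C3 ^ (1 - β) * ((1 + M) ^ (1 / β)) ^ (1 - β) * (T - S) ^ β * (C1 * (1 + M)) := by
        rw [e1]
        gcongr
    _ = C3 ^ (1 - β) * C1 * (((1 + M) ^ (1 / β)) ^ (1 - β) * (1 + M)) * (T - S) ^ β := by ring
    _ = _ := by rw [e3]

end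

/-! ### Dyadic chaining -/

/-- The dyadic approximation of level `m` from below. -/
noncomputable def dyadicFloor (m : ℕ) (t : ℝ) : ℝ := (⌊t * 2 ^ m⌋₊ : ℝ) / 2 ^ m

lemma dyadicFloor_le {t : ℝ} (ht : 0 ≤ t) (m : ℕ) : dyadicFloor m t ≤ t := by
  rw [dyadicFloor, div_le_iff₀ (by positivity)]
  exact Nat.floor_le (by positivity)

lemma tendsto_dyadicFloor {t : ℝ} (ht : 0 ≤ t) :
    Tendsto (fun m => dyadicFloor m t) atTop (𝓝 t) := by
  have h := (tendsto_nat_floor_mul_div_atTop (R := ℝ) ht).comp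
    (tendsto_pow_atTop_atTop_of_one_lt (one_lt_two (α := ℝ)))
  exact h

/-- Consecutive dyadic floors are equal or adjacent points of the finer grid. -/
lemma abs_sub_dyadicFloor_succ_le {g : ℝ → ℝ} {A D ρ : ℝ} (hρ : 0 < ρ) (hD : 0 ≤ D)
    (h : ∀ m k : ℕ, ((k : ℝ) + 1) / 2 ^ m ≤ A →
      |g (((k : ℝ) + 1) / 2 ^ m) - g ((k : ℝ) / 2 ^ m)| ≤ D * ρ ^ m)
    {t : ℝ} (ht : 0 ≤ t) (htA : t ≤ A) (m : ℕ) :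
    |g (dyadicFloor (m + 1) t) - g (dyadicFloor m t)| ≤ D * ρ ^ (m + 1) := by
  have hle := dyadicFloor_le ht (m + 1)
  have e1 : dyadicFloor m t = ((2 * ⌊t * 2 ^ m⌋₊ : ℕ) : ℝ) / 2 ^ (m + 1) := by
    rw [dyadicFloor, pow_succ]
    push_cast
    field_simp
  have b1 : 2 * ⌊t * 2 ^ m⌋₊ ≤ ⌊t * 2 ^ (m + 1)⌋₊ := by
    refine Nat.le_floor ?_
    push_cast
    have := Nat.floor_le (a := t * 2 ^ m) (by positivity)
    rw [pow_succ]
    linarith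
  have b2 : ⌊t * 2 ^ (m + 1)⌋₊ < 2 * ⌊t * 2 ^ m⌋₊ + 2 := by
    rw [Nat.floor_lt (by positivity)]
    push_cast
    have := Nat.lt_floor_add_one (t * 2 ^ m)
    rw [pow_succ]
    linarith
  rcases (by omega : ⌊t * 2 ^ (m + 1)⌋₊ = 2 * ⌊t * 2 ^ m⌋₊ ∨
    ⌊t * 2 ^ (m + 1)⌋₊ = 2 * ⌊t * 2 ^ m⌋₊ + 1) with h1 | h1
  · rw [e1, dyadicFloor, h1, sub_self, abs_zero]
    positivity
  · rw [e1]
    rw [dyadicFloor, h1, Nat.cast_add_one] at hle ⊢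
    exact h (m + 1) _ (hle.trans htA)

lemma abs_sub_dyadicFloor_le {g : ℝ → ℝ} {A D ρ : ℝ} (hg : Continuous g) (hρ : 0 < ρ)
    (hρ1 : ρ < 1) (hD : 0 ≤ D)
    (h : ∀ m k : ℕ, ((k : ℝ) + 1) / 2 ^ m ≤ A →
      |g (((k : ℝ) + 1) / 2 ^ m) - g ((k : ℝ) / 2 ^ m)| ≤ D * ρ ^ m)
    {t : ℝ} (ht : 0 ≤ t) (htA : t ≤ A) (m : ℕ) :
    |g t - g (dyadicFloor m t)| ≤ D * ρ ^ m * (ρ / (1 - ρ)) := by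
  have h1ρ : 0 < 1 - ρ := by linarith
  -- The factor `1 - ρ^j` makes this the exact geometric partial sum, so the induction closes.
  have key : ∀ j : ℕ, |g (dyadicFloor (m + j) t) - g (dyadicFloor m t)| ≤
      D * ρ ^ m * (ρ / (1 - ρ)) * (1 - ρ ^ j) := by
    intro j
    induction j with
    | zero => simp
    | succ j ih =>
      have h1 := abs_sub_dyadicFloor_succ_le hρ hD h ht htA (m + j)
      have h2 := abs_add_le (g (dyadicFloor (m + j + 1) t) - g (dyadicFloor (m + j) t))
        (g (dyadicFloor (m + j) t) - g (dyadicFloor m t))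
      rw [sub_add_sub_cancel] at h2
      have h3 : D * ρ ^ (m + j + 1) + D * ρ ^ m * (ρ / (1 - ρ)) * (1 - ρ ^ j) =
          D * ρ ^ m * (ρ / (1 - ρ)) * (1 - ρ ^ (j + 1)) := by
        field_simp
        ring
      rw [← add_assoc]
      linarith
  have lim : Tendsto (fun j => |g (dyadicFloor (m + j) t) - g (dyadicFloor m t)|) atTop
      (𝓝 |g t - g (dyadicFloor m t)|) := by
    have h1 : Tendsto (fun j => dyadicFloor (m + j) t) atTop (𝓝 t) :=
      (tendsto_dyadicFloor ht).comp (tendsto_add_atTop_nat m |>.congr fun j => add_comm j m)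
    exact (((hg.tendsto t).comp h1).sub_const _).abs
  refine le_of_tendsto lim (Eventually.of_forall fun j => (key j).trans ?_)
  refine mul_le_of_le_one_right (by positivity) ?_
  linarith [pow_pos hρ j]

/-- Hölder continuity from bounds on dyadic increments. -/
theorem abs_sub_le_of_dyadic_increments {g : ℝ → ℝ} {A D β : ℝ} (hg : Continuous g) (hβ : 0 < β)
    (hD : 0 ≤ D)
    (h : ∀ m k : ℕ, ((k : ℝ) + 1) / 2 ^ m ≤ A →
      |g (((k : ℝ) + 1) / 2 ^ m) - g ((k : ℝ) / 2 ^ m)| ≤ D * ((1 / 2 : ℝ) ^ β) ^ m)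
    {s t : ℝ} (hs : 0 ≤ s) (hst : s ≤ t) (htA : t ≤ A) (hst1 : t - s ≤ 1) :
    |g t - g s| ≤ ((1 / 2 : ℝ) ^ β)⁻¹ * (1 + 2 * ((1 / 2 : ℝ) ^ β / (1 - (1 / 2 : ℝ) ^ β))) * D *
      (t - s) ^ β := by
  set ρ := (1 / 2 : ℝ) ^ β with hρdef
  have hρ : 0 < ρ := Real.rpow_pos_of_pos (by norm_num) _
  have hρ1 : ρ < 1 := Real.rpow_lt_one (by norm_num) (by norm_num) hβ
  rcases hst.eq_or_lt with rfl | hlt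
  · simp [Real.zero_rpow hβ.ne']
  -- At the level with `2^(-m-1) < t - s ≤ 2^(-m)`, the floors of `s` and `t` are equal or adjacent.
  obtain ⟨m, hm1, hm2⟩ := exists_nat_pow_near_of_lt_one (sub_pos.2 hlt) hst1
    (by norm_num : (0 : ℝ) < 1 / 2) (by norm_num)
  have a1 := abs_sub_dyadicFloor_le hg hρ hρ1 hD h (hs.trans hst) htA m
  have a2 := abs_sub_dyadicFloor_le hg hρ hρ1 hD h hs (hst.trans htA) m
  have b1 : ⌊s * 2 ^ m⌋₊ ≤ ⌊t * 2 ^ m⌋₊ := Nat.floor_mono (by gcongr)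
  have b2 : ⌊t * 2 ^ m⌋₊ < ⌊s * 2 ^ m⌋₊ + 2 := by
    rw [Nat.floor_lt (by have := hs.trans hst; positivity)]
    push_cast
    have h1 := Nat.lt_floor_add_one (s * 2 ^ m)
    have h2 : (t - s) * 2 ^ m ≤ 1 := by
      calc (t - s) * 2 ^ m ≤ (1 / 2 : ℝ) ^ m * 2 ^ m := by gcongr
        _ = 1 := by rw [← mul_pow]; norm_num
    linarith
  have a3 : |g (dyadicFloor m t) - g (dyadicFloor m s)| ≤ D * ρ ^ m := by
    have hle := dyadicFloor_le (hs.trans hst) m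
    rcases (by omega : ⌊t * 2 ^ m⌋₊ = ⌊s * 2 ^ m⌋₊ ∨ ⌊t * 2 ^ m⌋₊ = ⌊s * 2 ^ m⌋₊ + 1)
      with h1 | h1
    · rw [dyadicFloor, h1, dyadicFloor, sub_self, abs_zero]
      positivity
    · rw [dyadicFloor, h1, Nat.cast_add_one] at hle ⊢
      rw [dyadicFloor]
      exact h m _ (hle.trans htA)
  have a4 : |g t - g s| ≤ D * ρ ^ m * (1 + 2 * (ρ / (1 - ρ))) := by
    have e1 := abs_add_three (g t - g (dyadicFloor m t))
      (g (dyadicFloor m t) - g (dyadicFloor m s)) (g (dyadicFloor m s) - g s)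
    rw [abs_sub_comm (g s)] at a2
    have e2 : g t - g (dyadicFloor m t) + (g (dyadicFloor m t) - g (dyadicFloor m s)) +
      (g (dyadicFloor m s) - g s) = g t - g s := by ring
    rw [e2] at e1
    linarith
  have a5 : ρ ^ m ≤ ρ⁻¹ * (t - s) ^ β := by
    have e1 : ρ ^ (m + 1) = ((1 / 2 : ℝ) ^ (m + 1)) ^ β := by
      rw [hρdef, ← Real.rpow_natCast, ← Real.rpow_natCast, ← Real.rpow_mul (by norm_num),
        ← Real.rpow_mul (by norm_num), mul_comm]
    have e2 : ρ ^ (m + 1) ≤ (t - s) ^ β := by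
      rw [e1]
      exact Real.rpow_le_rpow (by positivity) hm1.le hβ.le
    rw [inv_mul_eq_div, le_div_iff₀ hρ, ← pow_succ]
    exact e2
  have h1ρ : 0 < 1 - ρ := by linarith
  calc |g t - g s| ≤ D * ρ ^ m * (1 + 2 * (ρ / (1 - ρ))) := a4
    _ ≤ D * (ρ⁻¹ * (t - s) ^ β) * (1 + 2 * (ρ / (1 - ρ))) := by gcongr
    _ = _ := by ring

/-! ### Hölder constants of fractional Brownian motion -/

section

variable {Ω : Type*} [MeasurableSpace Ω] {P : Measure Ω} [IsProbabilityMeasure P]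
  {H : ℝ} {B : ℝ≥0 → Ω → ℝ}

lemma IsFBM.map_increment (hB : IsFBM P H B) (hH : 0 < H) (s t : ℝ≥0) :
    P.map (fun ω => B t ω - B s ω) =
      gaussianReal 0 (|(t : ℝ) - s| ^ (2 * H)).toNNReal := by
  have hL := hB.gaussian.hasGaussianLaw_fun_sub (s := t) (t := s)
  have m : ∀ r, MemLp (B r) 2 P := fun r => (hB.gaussian.hasGaussianLaw_eval r).memLp_two
  have i : ∀ r, Integrable (B r) P := fun r => (m r).integrable (by norm_num)
  have ip : ∀ r q, Integrable (fun ω => B r ω * B q ω) P := fun r q =>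
    (m r).integrable_mul (m q)
  have h0 : ∫ ω, (B t ω - B s ω) ∂P = 0 := by
    rw [integral_sub (i t) (i s), hB.centered, hB.centered, sub_zero]
  have hz : (0 : ℝ) ^ (2 * H) = 0 := Real.zero_rpow (by linarith)
  have hv : ∫ ω, (B t ω - B s ω) ^ 2 ∂P = |(t : ℝ) - s| ^ (2 * H) := by
    have : ∀ ω, (B t ω - B s ω) ^ 2 = B t ω * B t ω - 2 * (B t ω * B s ω) + B s ω * B s ω := by
      intro ω
      ring
    simp_rw [this]
    have hi : Integrable (fun ω => B t ω * B t ω - 2 * (B t ω * B s ω)) P :=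
      (ip t t).sub ((ip t s).const_mul 2)
    rw [integral_add hi (ip s s), integral_sub (ip t t) ((ip t s).const_mul 2), integral_const_mul, hB.covariance,
      hB.covariance, hB.covariance, sub_self, sub_self, abs_zero, hz]
    ring
  rw [hL.map_eq_gaussianReal, variance_of_integral_eq_zero hL.aemeasurable h0, hv, h0]

/-- Normalized increments are all standard Gaussian, so a single constant serves every dyadic
increment. -/
lemma IsFBM.lintegral_exp_increment (hB : IsFBM P H B) (hH : 0 < H) {s t : ℝ≥0} (hst : s ≠ t)
    (c : ℝ) :
    ∫⁻ ω, ENNReal.ofReal (Real.exp (c * ((B t ω - B s ω) / |(t : ℝ) - s| ^ H) ^ 2)) ∂P =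
      ∫⁻ x, ENNReal.ofReal (Real.exp (c * x ^ 2)) ∂(gaussianReal 0 1) := by
  have hd : 0 < |(t : ℝ) - s| := by
    rw [abs_pos, sub_ne_zero]
    exact_mod_cast hst.symm
  have hr := Real.rpow_pos_of_pos hd H
  have hm : AEMeasurable (fun ω => B t ω - B s ω) P :=
    (hB.gaussian.aemeasurable t).sub (hB.gaussian.aemeasurable s)
  have h1 : gaussianReal 0 1 =
      (P.map (fun ω => B t ω - B s ω)).map (fun y => (|(t : ℝ) - s| ^ H)⁻¹ * y) := by
    rw [hB.map_increment hH, gaussianReal_map_const_mul, mul_zero]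
    congr 1
    ext
    simp only [NNReal.coe_mul, NNReal.coe_mk, NNReal.coe_one]
    rw [Real.coe_toNNReal _ (by positivity), mul_comm 2 H, Real.rpow_mul hd.le, Real.rpow_two]
    field_simp
  rw [h1, lintegral_map (by fun_prop) (by fun_prop), lintegral_map' (by fun_prop) hm]
  refine lintegral_congr fun ω => ?_
  rw [inv_mul_eq_div]

lemma summable_dyadic_weights :
    Summable fun i : ℕ × ℕ => (1 / 2 : ℝ) ^ i.1 * (1 / ((i.2 : ℝ) + 1) ^ 2) := by
  have h1 : Summable fun k : ℕ => 1 / ((k : ℝ) + 1) ^ 2 := by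
    have h := Real.summable_one_div_nat_pow.2 one_lt_two
    rw [← summable_nat_add_iff 1] at h
    simpa only [Nat.cast_add, Nat.cast_one] using h
  have h2 : (0 : ℕ → ℝ) ≤ fun m : ℕ => (1 / 2 : ℝ) ^ m := Pi.le_def.2 fun m => by
    rw [Pi.zero_apply]
    positivity
  have h3 : (0 : ℕ → ℝ) ≤ fun k : ℕ => 1 / ((k : ℝ) + 1) ^ 2 := Pi.le_def.2 fun k => by
    rw [Pi.zero_apply]
    positivity
  exact summable_geometric_two.mul_of_nonneg h1 h2 h3

/-- A random variable with a Gaussian-type exponential moment dominating all dyadic increments. -/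
theorem IsFBM.exists_dyadic_bound (hB : IsFBM P H B) (hH : 0 < H) :
    ∃ (c : ℝ) (ξ : Ω → ℝ), 0 < c ∧ Measurable ξ ∧ (∀ ω, 1 ≤ ξ ω) ∧
      Integrable (fun ω => Real.exp (ξ ω ^ 2)) P ∧
      ∀ᵐ ω ∂P, ∀ m k : ℕ,
        (path B ω (((k : ℝ) + 1) / 2 ^ m) - path B ω ((k : ℝ) / 2 ^ m)) ^ 2 ≤
          c * ξ ω ^ 2 * (1 + m + 2 * Real.log (k + 1)) * ((1 / 2 : ℝ) ^ m) ^ (2 * H) := by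
  obtain ⟨c, hc, hci⟩ := IsGaussian.exists_integrable_exp_sq (gaussianReal 0 1)
  simp only [Real.norm_eq_abs, sq_abs] at hci
  set N : ℕ × ℕ → Ω → ℝ := fun i ω =>
    (path B ω (((i.2 : ℝ) + 1) / 2 ^ i.1) - path B ω ((i.2 : ℝ) / 2 ^ i.1)) /
      ((1 / 2 : ℝ) ^ i.1) ^ H with hN
  -- Summable weights whose negative logarithms grow only linearly in the level and logarithmically
  -- in the position; they produce the factor `1 + m + 2 log (k + 1)`.
  set w : ℕ × ℕ → ℝ := fun i => (1 / 2) ^ i.1 * (1 / ((i.2 : ℝ) + 1) ^ 2) with hw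
  have hw0 : ∀ i, 0 < w i := fun i => by simp only [hw]; positivity
  have hws : Summable w := summable_dyadic_weights
  have hmeas : ∀ i, AEMeasurable (N i) P := fun i =>
    ((hB.gaussian.aemeasurable _).sub (hB.gaussian.aemeasurable _)).div_const _
  set F : ℕ × ℕ → Ω → ℝ≥0∞ := fun i ω => ENNReal.ofReal (w i) *
    ENNReal.ofReal (Real.exp (c * N i ω ^ 2)) with hF
  have hFm : ∀ i, AEMeasurable (F i) P := fun i => by
    have := hmeas i
    simp only [hF]
    fun_prop
  set I := ∫⁻ x, ENNReal.ofReal (Real.exp (c * x ^ 2)) ∂(gaussianReal 0 1) with hI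
  have hI1 : I ≠ ∞ := hci.lintegral_lt_top.ne
  have hFI : ∀ i, ∫⁻ ω, F i ω ∂P = ENNReal.ofReal (w i) * I := by
    intro i
    have e0 : (0 : ℝ) ≤ (i.2 : ℝ) / 2 ^ i.1 := by positivity
    have e1 : (0 : ℝ) ≤ ((i.2 : ℝ) + 1) / 2 ^ i.1 := by positivity
    have e2 : |((((i.2 : ℝ) + 1) / 2 ^ i.1).toNNReal : ℝ) - (((i.2 : ℝ) / 2 ^ i.1).toNNReal : ℝ)| =
        (1 / 2 : ℝ) ^ i.1 := by
      rw [Real.coe_toNNReal _ e0, Real.coe_toNNReal _ e1, ← sub_div, add_sub_cancel_left,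
        abs_of_pos (by positivity), one_div_pow]
    have e3 : ((i.2 : ℝ) / 2 ^ i.1).toNNReal ≠ (((i.2 : ℝ) + 1) / 2 ^ i.1).toNNReal := by
      intro h
      rw [h, sub_self, abs_zero] at e2
      have : (0 : ℝ) < (1 / 2) ^ i.1 := by positivity
      linarith
    have h1 := hB.lintegral_exp_increment hH e3 c
    rw [e2] at h1
    simp only [hF]
    rw [lintegral_const_mul' _ _ ENNReal.ofReal_ne_top, hI, ← h1]
    rfl
  have hTm : AEMeasurable (fun ω => ∑' i, F i ω) P := AEMeasurable.tsum hFm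
  have hTfin : ∫⁻ ω, ∑' i, F i ω ∂P ≠ ∞ := by
    rw [lintegral_tsum hFm]
    simp_rw [hFI]
    rw [ENNReal.tsum_mul_right, ← ENNReal.ofReal_tsum_of_nonneg (fun i => (hw0 i).le) hws]
    exact ENNReal.mul_ne_top ENNReal.ofReal_ne_top hI1
  set T : Ω → ℝ := fun ω => (hTm.mk _ ω).toReal with hT
  have hTmeas : Measurable T := hTm.measurable_mk.ennreal_toReal
  have hT0 : ∀ ω, 0 ≤ T ω := fun ω => ENNReal.toReal_nonneg
  have hTint : Integrable T P := by
    refine integrable_toReal_of_lintegral_ne_top hTm.measurable_mk.aemeasurable ?_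
    rwa [← lintegral_congr_ae hTm.ae_eq_mk]
  have hlog : ∀ ω, 0 ≤ Real.log (1 + T ω) := fun ω => Real.log_nonneg (by linarith [hT0 ω])
  have hsq : ∀ ω, √(1 + Real.log (1 + T ω)) ^ 2 = 1 + Real.log (1 + T ω) := fun ω =>
    Real.sq_sqrt (by linarith [hlog ω])
  -- Chosen so that `exp (ξ²) = e (1 + T)`, which is integrable.
  refine ⟨c⁻¹, fun ω => √(1 + Real.log (1 + T ω)), inv_pos.2 hc, by fun_prop, fun ω => ?_, ?_, ?_⟩
  · rw [Real.one_le_sqrt]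
    linarith [hlog ω]
  · have : ∀ ω, Real.exp (√(1 + Real.log (1 + T ω)) ^ 2) = Real.exp 1 * (1 + T ω) := fun ω => by
      rw [hsq, Real.exp_add, Real.exp_log (by linarith [hT0 ω])]
    simp_rw [this]
    exact ((integrable_const 1).add hTint).const_mul _
  · filter_upwards [hTm.ae_eq_mk, ae_lt_top' hTm hTfin] with ω h1 h2 m k
    rw [hsq]
    have h3 : w (m, k) * Real.exp (c * N (m, k) ω ^ 2) ≤ T ω := by
      have h4 : F (m, k) ω ≤ ∑' i, F i ω := ENNReal.le_tsum (m, k)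
      have h5 := ENNReal.toReal_mono h2.ne h4
      simp only [hF] at h5
      rw [ENNReal.toReal_mul, ENNReal.toReal_ofReal (hw0 _).le,
        ENNReal.toReal_ofReal (Real.exp_pos _).le] at h5
      simp only [hT, ← h1]
      exact h5
    have h6 : Real.log (w (m, k) * Real.exp (c * N (m, k) ω ^ 2)) ≤ Real.log (1 + T ω) :=
      Real.log_le_log (mul_pos (hw0 _) (Real.exp_pos _)) (by linarith)
    have hk : (0 : ℝ) < (k : ℝ) + 1 := by positivity
    have h7 : Real.log (w (m, k)) = -(m * Real.log 2) - 2 * Real.log (k + 1) := by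
      simp only [hw]
      rw [Real.log_mul (by positivity) (by positivity), Real.log_pow, Real.log_div one_ne_zero
        (by positivity), Real.log_div one_ne_zero (by positivity), Real.log_pow, Real.log_one]
      push_cast
      ring
    rw [Real.log_mul (hw0 _).ne' (Real.exp_pos _).ne', Real.log_exp, h7] at h6
    have hl2 : Real.log 2 ≤ 1 := by linarith [Real.log_two_lt_d9]
    have hlk : 0 ≤ Real.log ((k : ℝ) + 1) := Real.log_nonneg (by linarith [k.cast_nonneg (α := ℝ)])
    have hm0 : (0 : ℝ) ≤ m := m.cast_nonneg
    have h8 : c * N (m, k) ω ^ 2 ≤ (1 + Real.log (1 + T ω)) * (1 + m + 2 * Real.log (k + 1)) := by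
      have : m * Real.log 2 ≤ m := mul_le_of_le_one_right hm0 hl2
      nlinarith [mul_nonneg (hlog ω) hm0, mul_nonneg (hlog ω) hlk]
    have hd : (0 : ℝ) < (1 / 2 : ℝ) ^ m := by positivity
    have h9 : (path B ω (((k : ℝ) + 1) / 2 ^ m) - path B ω ((k : ℝ) / 2 ^ m)) ^ 2 =
        N (m, k) ω ^ 2 * ((1 / 2 : ℝ) ^ m) ^ (2 * H) := by
      simp only [hN]
      rw [mul_comm 2 H, Real.rpow_mul hd.le, Real.rpow_two, div_pow]
      have := (Real.rpow_pos_of_pos hd H).ne'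
      field_simp
    rw [h9]
    gcongr
    rw [mul_assoc, inv_mul_eq_div, le_div_iff₀ hc, mul_comm]
    exact h8

lemma one_add_mul_le_const_mul_pow {r : ℝ} (hr : 1 < r) :
    ∃ C : ℝ, 0 < C ∧ ∀ m : ℕ, 1 + 3 * (m : ℝ) ≤ C * r ^ m := by
  have hr' : 0 < r - 1 := by linarith
  refine ⟨1 + 3 / (r - 1), by positivity, fun m => ?_⟩
  have h := one_add_mul_le_pow (a := r - 1) (by linarith) m
  rw [add_sub_cancel] at h
  have h1 : 1 ≤ r ^ m := one_le_pow₀ hr.le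
  have h2 : 3 * (m : ℝ) ≤ 3 / (r - 1) * r ^ m := by
    rw [div_mul_eq_mul_div, le_div_iff₀ hr']
    linarith
  linarith

/-- Local Hölder constants of fractional Brownian motion grow like the square root of
a logarithm. -/
theorem IsFBM.exists_holder_bound (hB : IsFBM P H B) {β : ℝ} (hβ : 0 < β) (hβH : β < H) :
    ∃ (C : ℝ) (ξ : Ω → ℝ), 0 < C ∧ Measurable ξ ∧ (∀ ω, 1 ≤ ξ ω) ∧
      Integrable (fun ω => Real.exp (ξ ω ^ 2)) P ∧
      ∀ᵐ ω ∂P, ∀ A s t : ℝ, 1 ≤ A → 0 ≤ s → s ≤ t → t ≤ A → t - s ≤ 1 →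
        |path B ω t - path B ω s| ≤ C * ξ ω * √(1 + 2 * Real.log A) * (t - s) ^ β := by
  obtain ⟨c, ξ, hc, hξm, hξ1, hξi, hξ⟩ := hB.exists_dyadic_bound (hβ.trans hβH)
  -- The gap `H - β` gives geometric room to absorb the linear factor `1 + 3m` arising at level `m`.
  set q : ℝ := (1 / 2 : ℝ) ^ (2 * (H - β)) with hq
  have hq0 : 0 < q := Real.rpow_pos_of_pos (by norm_num) _
  have hq1 : q < 1 := Real.rpow_lt_one (by norm_num) (by norm_num) (by linarith)
  obtain ⟨C0, hC0, hC0m⟩ := one_add_mul_le_const_mul_pow ((one_lt_inv₀ hq0).2 hq1)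
  set ρ := (1 / 2 : ℝ) ^ β with hρdef
  have hρ : 0 < ρ := Real.rpow_pos_of_pos (by norm_num) _
  have hρ1 : 0 < 1 - ρ := sub_pos.2 (Real.rpow_lt_one (by norm_num) (by norm_num) hβ)
  refine ⟨ρ⁻¹ * (1 + 2 * (ρ / (1 - ρ))) * √(c * C0), ξ, by positivity, hξm, hξ1, hξi, ?_⟩
  filter_upwards [hξ, hB.continuous_paths] with ω h hcont A s t hA hs hst ht hst1
  have hg : Continuous (path B ω) := hcont.comp continuous_real_toNNReal
  have hlA : 0 ≤ Real.log A := Real.log_nonneg hA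
  have hξ0 : 0 ≤ ξ ω := zero_le_one.trans (hξ1 ω)
  have := abs_sub_le_of_dyadic_increments (A := A) (D := √(c * C0) * ξ ω * √(1 + 2 * Real.log A))
    hg hβ (by positivity) ?_ hs hst ht hst1
  · refine this.trans (le_of_eq ?_)
    ring
  · intro m k hk
    have hm0 : (0 : ℝ) ≤ m := m.cast_nonneg
    refine abs_le_of_sq_le_sq ?_ (by positivity)
    refine (h m k).trans ?_
    -- Dyadic points of level `m` in `[0, A]` have index at most `A 2^m`: this is where the
    -- logarithmic growth in time comes from.
    have h1 : Real.log (k + 1) ≤ Real.log A + m := by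
      have hk' : (k : ℝ) + 1 ≤ A * 2 ^ m := (div_le_iff₀ (by positivity)).1 hk
      have h2 := Real.log_le_log (by positivity) hk'
      rw [Real.log_mul (by linarith) (by positivity), Real.log_pow] at h2
      have hl2 : Real.log 2 ≤ 1 := by linarith [Real.log_two_lt_d9]
      have : m * Real.log 2 ≤ m := mul_le_of_le_one_right hm0 hl2
      linarith
    have h2 : 1 + m + 2 * Real.log (k + 1) ≤ C0 * q⁻¹ ^ m * (1 + 2 * Real.log A) := by
      have h3 : 1 + m + 2 * Real.log (k + 1) ≤ (1 + 3 * m) * (1 + 2 * Real.log A) := by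
        nlinarith [mul_nonneg hm0 hlA]
      refine h3.trans ?_
      have := hC0m m
      gcongr
    have h3 : ((1 / 2 : ℝ) ^ m) ^ (2 * H) = q ^ m * (ρ ^ m) ^ 2 := by
      rw [← pow_mul, mul_comm m 2, pow_mul, ← mul_pow, ← Real.rpow_natCast,
        ← Real.rpow_mul (by norm_num), mul_comm (m : ℝ), Real.rpow_mul (by norm_num),
        Real.rpow_natCast, hq, hρdef, ← Real.rpow_two, ← Real.rpow_mul (by norm_num),
        ← Real.rpow_add (by norm_num)]
      congr 2
      ring
    calc _ ≤ c * ξ ω ^ 2 * (C0 * q⁻¹ ^ m * (1 + 2 * Real.log A)) *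
          ((1 / 2 : ℝ) ^ m) ^ (2 * H) := by gcongr
      _ = (c * C0) * ξ ω ^ 2 * (1 + 2 * Real.log A) * (ρ ^ m) ^ 2 * (q⁻¹ ^ m * q ^ m) := by
          rw [h3]
          ring
      _ = _ := by
          rw [← mul_pow, inv_mul_cancel₀ hq0.ne', one_pow, mul_one, mul_pow, mul_pow, mul_pow,
            Real.sq_sqrt (by positivity), Real.sq_sqrt (by positivity)]

end

/-! ### Logarithmic factors, local to global, and the equation as a controlled path -/

/-- Raising the exponent of `log (t + 2)` costs a constant, because this logarithm is only bounded
below by `log 2 < 1`. -/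
lemma rpow_le_const_mul_rpow {ℓ₀ ℓ p q : ℝ} (h0 : 0 < ℓ₀) (hℓ : ℓ₀ ≤ ℓ) (hpq : p ≤ q) :
    ℓ ^ p ≤ ℓ₀ ^ (p - q) * ℓ ^ q := by
  have hpos : 0 < ℓ := h0.trans_le hℓ
  have h1 : ℓ ^ p = ℓ ^ (p - q) * ℓ ^ q := by
    rw [← Real.rpow_add hpos, sub_add_cancel]
  rw [h1]
  exact mul_le_mul_of_nonneg_right (Real.rpow_le_rpow_of_nonpos h0 hℓ (by linarith))
    (Real.rpow_nonneg hpos.le _)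

lemma log_two_le_log_add_two {t : ℝ} (ht : 0 ≤ t) : Real.log 2 ≤ Real.log (t + 2) :=
  Real.log_le_log (by norm_num) (by linarith)

lemma exists_sqrt_log_bound {γ : ℝ} (hγ : 1 / 2 < γ) :
    ∃ C : ℝ, 0 < C ∧ ∀ t : ℝ, 0 ≤ t →
      √(1 + 2 * Real.log (t + 1)) ≤ C * Real.log (t + 2) ^ γ := by
  have hl := Real.log_pos one_lt_two
  set C1 := 1 / Real.log 2 + 2 with hC1
  have hC10 : 0 < C1 := by positivity
  refine ⟨√C1 * Real.log 2 ^ (1 / 2 - γ), by positivity, fun t ht => ?_⟩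
  have h2 := log_two_le_log_add_two ht
  have h1 : 1 + 2 * Real.log (t + 1) ≤ C1 * Real.log (t + 2) := by
    have e1 : Real.log (t + 1) ≤ Real.log (t + 2) :=
      Real.log_le_log (by linarith) (by linarith)
    have e2 : 1 ≤ 1 / Real.log 2 * Real.log (t + 2) := by
      rw [one_div_mul_eq_div, le_div_iff₀ hl]
      linarith
    rw [hC1, add_mul]
    linarith
  calc √(1 + 2 * Real.log (t + 1)) ≤ √(C1 * Real.log (t + 2)) := Real.sqrt_le_sqrt h1
    _ = √C1 * Real.log (t + 2) ^ (1 / 2 : ℝ) := by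
        rw [Real.sqrt_mul hC10.le, Real.sqrt_eq_rpow (Real.log (t + 2))]
    _ ≤ √C1 * (Real.log 2 ^ (1 / 2 - γ) * Real.log (t + 2) ^ γ) := by
        gcongr
        exact rpow_le_const_mul_rpow hl h2 hγ.le
    _ = _ := by ring

/-- Provides some Hölder constant on all of `[0, A]`, as additivity of integrals started at `0`
requires; its size never enters the estimates. -/
lemma holderBound_of_local {M β A : ℝ} {g : ℝ → ℝ} (hg : Continuous g) (hM : 0 ≤ M) (hβ : 0 < β)
    (h : ∀ s t, 0 ≤ s → s ≤ t → t ≤ A → t - s ≤ 1 → |g t - g s| ≤ M * (t - s) ^ β) :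
    ∃ M', 0 ≤ M' ∧ HolderBound M' β 0 A g := by
  obtain ⟨C, hC⟩ := (isCompact_Icc (a := 0) (b := A)).exists_bound_of_continuousOn hg.continuousOn
  refine ⟨M + 2 * |C|, by positivity, fun s t hs hst ht => ?_⟩
  have h0 : 0 ≤ (t - s) ^ β := Real.rpow_nonneg (by linarith) _
  have hC0 := abs_nonneg C
  rcases le_total (t - s) 1 with h1 | h1
  · refine (h s t hs hst ht h1).trans ?_
    gcongr
    linarith
  · have e1 : |g t - g s| ≤ 2 * |C| := by
      have a1 := hC t ⟨hs.trans hst, ht⟩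
      have a2 := hC s ⟨hs, hst.trans ht⟩
      have a3 := norm_sub_le (g t) (g s)
      rw [Real.norm_eq_abs] at a3
      linarith [le_abs_self C]
    have e2 : 1 ≤ (t - s) ^ β := Real.one_le_rpow h1 hβ.le
    nlinarith

lemma HolderBound.of_local_two {M β S T : ℝ} {g : ℝ → ℝ} (hM : 0 ≤ M) (hβ : 0 < β)
    (h : ∀ s t, S ≤ s → s ≤ t → t ≤ T → t - s ≤ 1 → |g t - g s| ≤ M * (t - s) ^ β)
    (hST : T - S ≤ 2) : HolderBound (2 * M) β S T g := by
  intro s t hs hst ht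
  have h1 := h s ((s + t) / 2) hs (by linarith) (by linarith) (by linarith)
  have h2 := h ((s + t) / 2) t (by linarith) (by linarith) ht (by linarith)
  have h3 := abs_add_le (g t - g ((s + t) / 2)) (g ((s + t) / 2) - g s)
  rw [sub_add_sub_cancel] at h3
  have h4 : ((s + t) / 2 - s) ^ β ≤ (t - s) ^ β :=
    Real.rpow_le_rpow (by linarith) (by linarith) hβ.le
  have h5 : (t - (s + t) / 2) ^ β ≤ (t - s) ^ β :=
    Real.rpow_le_rpow (by linarith) (by linarith) hβ.le
  have h6 := mul_le_mul_of_nonneg_left h4 hM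
  have h7 := mul_le_mul_of_nonneg_left h5 hM
  linarith

lemma HolderBound.Lambda_le {α β β' M t₁ t₂ : ℝ} {g : ℝ → ℝ} (hα : 0 < α) (hα1 : α < 1)
    (hαβ : 1 < α + β') (hββ : β ≤ β') (hM : 0 ≤ M) (ht : t₂ - t₁ ≤ 1)
    (hg : HolderBound M β' t₁ t₂ g) :
    Lambda α β g t₁ t₂ ≤
      ENNReal.ofReal (max 1 (M * ((1 + (1 - α) / (α + β' - 1)) / Real.Gamma α))) := by
  rw [Lambda, ENNReal.ofReal_max, ENNReal.ofReal_one]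
  refine max_le_max le_rfl (iSup_le fun u => iSup_le fun v => iSup_le fun huv => ?_)
  refine ENNReal.ofReal_le_ofReal ?_
  obtain ⟨hu, huv, hv⟩ := huv
  have hd : 0 < v - u := by linarith
  have hΓ := Real.Gamma_pos_of_pos hα
  have h1 := (hg.mono hu hv).abs_rightCore_le hα1 hαβ huv.le
  have h2 : (v - u) ^ (α + β' - 1) ≤ (v - u) ^ (β + α - 1) :=
    Real.rpow_le_rpow_of_exponent_ge hd (by linarith) (by linarith)
  have h3 : 0 ≤ 1 + (1 - α) / (α + β' - 1) :=
    add_nonneg zero_le_one (div_nonneg (by linarith) (by linarith))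
  rw [norm_Z hα, div_le_iff₀ (Real.rpow_pos_of_pos hd _), div_le_iff₀ hΓ]
  calc _ ≤ M * (1 + (1 - α) / (α + β' - 1)) * (v - u) ^ (α + β' - 1) := h1
    _ ≤ M * (1 + (1 - α) / (α + β' - 1)) * (v - u) ^ (β + α - 1) := by gcongr
    _ = _ := by field_simp

/-- Additivity turns the difference of two integrals from `0` into an integral over `[s, t]`. Two
Hölder constants appear: `M'` on the whole past only justifies additivity, while the local `M` is
the one retained. -/
lemma controlledPath_of_equation {α β K L M M' S T x₀ : ℝ} {a b x g : ℝ → ℝ}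
    (hα : 0 < α) (hα1 : α < 1) (hαβ : 1 < α + β) (hM' : 0 ≤ M') (hS : 0 ≤ S)
    (hbdd : ∀ y, |a y| + |b y| ≤ K) (hlip : ∀ y z, |a y - a z| + |b y - b z| ≤ L * |y - z|)
    (ha : Continuous a) (hb : Continuous b) (hx : Continuous x) (hg : Continuous g)
    (hgM : HolderBound M β S (T + 1) g) (hgM' : HolderBound M' β 0 (T + 1) g)
    (hint : LeftFracIntegrable α 0 T (fun s => b (x s)))
    (heq : ∀ t : ℝ, 0 ≤ t → (x t : ℂ) = (x₀ : ℂ) + ((∫ s in (0 : ℝ)..t, a (x s) : ℝ) : ℂ) +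
      glsIntegral α 0 t (fun s => b (x s)) g) :
    ControlledPath α β K L (1 / (Real.Gamma α * Real.Gamma (1 - α))) M S T x
      (fun s => b (x s)) g where
  f_cont := hb.comp hx
  f_bdd u := by linarith [hbdd (x u), abs_nonneg (a (x u))]
  f_lip u v := by linarith [hlip (x u) (x v), abs_nonneg (a (x u) - a (x v))]
  gagliardoFinite := GagliardoFinite.mono (show GagliardoFinite α _ 0 T from hint.2) hS le_rfl
  g_cont := hg
  g_holder := hgM
  incr := by
    intro s t hs hst ht
    have hG : GagliardoFinite α (fun s => b (x s)) 0 t :=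
      GagliardoFinite.mono (show GagliardoFinite α _ 0 T from hint.2) le_rfl ht
    have hs0 := hS.trans hs
    have e : ∀ t, 0 ≤ t → x t = x₀ + (∫ s in (0 : ℝ)..t, a (x s)) +
        -(1 / (Real.Gamma α * Real.Gamma (1 - α))) * realGls α 0 t (fun s => b (x s)) g := by
      intro t ht
      have h := heq t ht
      rw [glsIntegral_eq] at h
      exact_mod_cast h
    have hadd := realGls_add hα hα1 hαβ hM' hs0 hst (hb.comp hx) hG hg
      (hgM'.mono le_rfl (by linarith))
    have hac : Continuous fun s => a (x s) := ha.comp hx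
    have h1 : x t - x s = (∫ r in s..t, a (x r)) +
        -(1 / (Real.Gamma α * Real.Gamma (1 - α))) * realGls α s t (fun s => b (x s)) g := by
      rw [e t (hs0.trans hst), e s hs0, ← intervalIntegral.integral_add_adjacent_intervals
        (hac.intervalIntegrable 0 s) (hac.intervalIntegrable s t)]
      rw [Function.comp_def] at hadd
      rw [← hadd]
      ring
    have h2 : |∫ r in s..t, a (x r)| ≤ K * (t - s) := by
      rw [← Real.norm_eq_abs, ← abs_of_nonneg (sub_nonneg.2 hst)]
      refine intervalIntegral.norm_integral_le_of_norm_le_const fun r _ => ?_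
      rw [Real.norm_eq_abs]
      linarith [hbdd (x r), abs_nonneg (b (x r))]
    have hΓ : 0 ≤ 1 / (Real.Gamma α * Real.Gamma (1 - α)) := by
      have := Real.Gamma_pos_of_pos hα
      have := Real.Gamma_pos_of_pos (sub_pos.2 hα1)
      positivity
    rw [h1]
    refine (abs_add_le _ _).trans (add_le_add h2 (le_of_eq ?_))
    rw [abs_mul, abs_neg, abs_of_nonneg hΓ]

section Moments

variable {Ω : Type*} [MeasurableSpace Ω] {P : Measure Ω} {ξ : Ω → ℝ}

lemma integrable_exp_mul_of_le (hξm : Measurable ξ)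
    (hξ : Integrable (fun ω => Real.exp (ξ ω ^ 2)) P) {x : ℝ} (hx : x ≤ 1) :
    Integrable (fun ω => Real.exp (x * ξ ω ^ 2)) P := by
  refine hξ.mono' (by fun_prop) (Eventually.of_forall fun ω => ?_)
  rw [Real.norm_of_nonneg (Real.exp_pos _).le, Real.exp_le_exp]
  exact mul_le_of_le_one_left (sq_nonneg _) hx

/-- The exponential moments of `ξ²` are finite for all parameters below `1`, a neighbourhood of `0`,
so all its moments are finite. -/
lemma memLp_sq_of_integrable_exp (hξm : Measurable ξ)
    (hξ : Integrable (fun ω => Real.exp (ξ ω ^ 2)) P) {p : ℝ≥0∞} (hp : p ≠ ∞) :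
    MemLp (fun ω => ξ ω ^ 2) p P := by
  lift p to ℝ≥0 using hp
  refine memLp_of_mem_interior_integrableExpSet ?_ p
  refine mem_interior.2 ⟨Iio 1, fun x hx => ?_, isOpen_Iio, by simp⟩
  exact integrable_exp_mul_of_le hξm hξ hx.le

end Moments

end FracSDE

/-! ### Assembly of the main theorem -/

section

open FracSDE Set Filter Topology

theorem corollary1 {Ω : Type*} [MeasurableSpace Ω] (P : Measure Ω) [IsProbabilityMeasure P]
    (H α β : ℝ) (hH : 1 / 2 < H) (hH1 : H < 1)
    (hα : 1 - H < α) (hα1 : α < 1 / 2) (hβ : 1 / 2 < β) (hβ1 : β < H)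
    (B : ℝ≥0 → Ω → ℝ) (hB : FracSDE.IsFBM P H B)
    (a b : ℝ → ℝ) (hab : FracSDE.CoeffAssumptions H a b)
    (x₀ : ℝ) (X : ℝ≥0 → Ω → ℝ) (hX : FracSDE.IsSolution P α a b x₀ B X)
    (γ : ℝ) (hγ : 1 / 2 < γ) (κ : ℝ) (hκ : κ = γ / β) :
    ∃ ξ ζ : Ω → ℝ, Measurable ξ ∧ Measurable ζ ∧
      (∀ᵐ ω ∂P, ∀ t₁ t₂ : ℝ, 0 ≤ t₁ → t₁ < t₂ → t₂ ≤ t₁ + 1 →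
        |FracSDE.path X ω t₂ - FracSDE.path X ω t₁| ≤
            ζ ω * (t₂ - t₁) ^ β * (Real.log (t₂ + 2)) ^ κ ∧
        FracSDE.Lambda α β (FracSDE.path B ω) t₁ t₂ ≤
            ENNReal.ofReal (ξ ω * (Real.log (t₂ + 2)) ^ (κ * β))) ∧
      (∃ c : ℝ, 0 < c ∧ ∀ x : ℝ, x < c →
        Integrable (fun ω => Real.exp (x * ξ ω ^ 2)) P ∧
        Integrable (fun ω => Real.exp (x * ζ ω ^ (2 * β))) P) ∧
      (∀ p : ℝ≥0∞, p ≠ ∞ → MemLp ξ p P ∧ MemLp ζ p P) := by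
  have hl2 := Real.log_pos one_lt_two
  have hα0 : 0 < α := by linarith
  have hα1' : α < 1 := by linarith
  have hβ0 : 0 < β := by linarith
  have hγ0 : 0 < γ := by linarith
  -- The sum `α + β` need not exceed `1`, so the analysis is run with a larger exponent `β'`; one
  -- returns to `β` using `t₂ - t₁ ≤ 1`, `ξ ≥ 1` and `1 / β' ≤ 1 / β`.
  obtain ⟨β', hβ', hβ'H⟩ := exists_between (max_lt hβ1 (by linarith : 1 - α < H))
  have hββ : β < β' := (le_max_left _ _).trans_lt hβ'
  have hαβ : 1 < α + β' := by linarith [(le_max_right β (1 - α)).trans_lt hβ']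
  have hβ'0 : 0 < β' := by linarith
  obtain ⟨δ, K, L, -, -, hK, hL, hbdd, hlip, hbdiff, -⟩ := hab
  have ha : Continuous a := LipschitzWith.continuous (K := L.toNNReal) <|
    LipschitzWith.of_dist_le_mul fun y z => by
      rw [Real.dist_eq, Real.dist_eq, Real.coe_toNNReal _ hL.le]
      linarith [hlip y z, abs_nonneg (b y - b z)]
  have hΓ : 0 ≤ 1 / (Real.Gamma α * Real.Gamma (1 - α)) := by
    have := Real.Gamma_pos_of_pos hα0
    have := Real.Gamma_pos_of_pos (sub_pos.2 hα1')
    positivity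
  obtain ⟨CX, hCX, hX_bound⟩ := exists_controlledPath_bound (α := α) (β := β') hα0 hα1'
    (by linarith) (by linarith) hαβ hK.le hL.le hΓ
  obtain ⟨CB, ξ, hCB, hξm, hξ1, hξi, hξ⟩ := hB.exists_holder_bound hβ'0 hβ'H
  obtain ⟨Cl, hCl, hlog⟩ := exists_sqrt_log_bound hγ
  -- The local bound holds for increments of length at most `1`, while `[t₁, t₂ + 1]` may have
  -- length `2`; bisecting costs the factor `2`.
  set CM := 2 * (CB * Cl) with hCM
  have hCM0 : 0 < CM := by positivity
  have hpath : ∀ᵐ ω ∂P, ∀ t₁ t₂ : ℝ, 0 ≤ t₁ → t₁ < t₂ → t₂ ≤ t₁ + 1 →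
      HolderBound (CM * ξ ω * Real.log (t₂ + 2) ^ γ) β' t₁ (t₂ + 1) (path B ω) := by
    filter_upwards [hξ] with ω h t₁ t₂ ht₁ ht ht₂
    have hξ0 : 0 ≤ ξ ω := zero_le_one.trans (hξ1 ω)
    have hℓ : 0 < Real.log (t₂ + 2) := hl2.trans_le (log_two_le_log_add_two (by linarith))
    have := HolderBound.of_local_two (M := CB * ξ ω * (Cl * Real.log (t₂ + 2) ^ γ)) (β := β')
      (S := t₁) (T := t₂ + 1) (g := path B ω) (by positivity) hβ'0
      (fun s t hs hst htT hst1 => by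
        refine (h (t₂ + 1) s t (by linarith) (by linarith) hst htT hst1).trans ?_
        have h1 := hlog t₂ (by linarith)
        have h2 : 0 ≤ (t - s) ^ β' := Real.rpow_nonneg (by linarith) _
        gcongr) (by linarith)
    convert this using 1
    rw [hCM]
    ring
  set CΛ := (1 + (1 - α) / (α + β' - 1)) / Real.Gamma α with hCΛ
  have hCΛ0 : 0 < CΛ := by
    have := Real.Gamma_pos_of_pos hα0
    have : 0 < 1 - α := by linarith
    have : 0 < α + β' - 1 := by linarith
    positivity
  -- The second summand handles the `1 ∨` in `Λ_β`, since `1 ≤ (log 2)^(-γ) ξ (log (t₂ + 2))^γ`.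
  set c1 := CM * CΛ + (Real.log 2 ^ γ)⁻¹ with hc1
  have hc10 : 0 < c1 := by positivity
  -- The power of `log 2` pays for replacing `γ / β'` by `γ / β`; the final `1` ensures positivity,
  -- as `CX` may be `0`.
  set c2 := CX * ((CM + (Real.log 2 ^ γ)⁻¹) ^ (1 / β') * Real.log 2 ^ (γ / β' - γ / β)) + 1 with hc2
  have hc20 : 0 < c2 := by positivity
  have hκβ : κ * β = γ := by
    rw [hκ]
    field_simp
  have hξpos : ∀ ω, 0 < ξ ω := fun ω => zero_lt_one.trans_le (hξ1 ω)
  refine ⟨fun ω => c1 * ξ ω, fun ω => c2 * ξ ω ^ (1 / β), by fun_prop, by fun_prop, ?_, ?_, ?_⟩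
  · filter_upwards [hpath, hξ, hB.continuous_paths, hX.continuous_paths, hX.integrable,
      hX.equation] with ω hloc hloc' hBc hXc hint heq t₁ t₂ ht₁ ht ht₂
    have hBc' : Continuous (path B ω) := hBc.comp continuous_real_toNNReal
    have hXc' : Continuous (path X ω) := hXc.comp continuous_real_toNNReal
    have hℓ2 := log_two_le_log_add_two (ht₁.trans ht.le)
    set ℓ := Real.log (t₂ + 2) with hℓ
    have hℓ0 : 0 < ℓ := hl2.trans_le hℓ2
    have hξ0 := hξpos ω
    set M := CM * ξ ω * ℓ ^ γ with hM
    have hM0 : 0 ≤ M := by positivity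
    have hg := hloc t₁ t₂ ht₁ ht ht₂
    have hone : 1 ≤ (Real.log 2 ^ γ)⁻¹ * ξ ω * ℓ ^ γ := by
      have h1 : Real.log 2 ^ γ ≤ ℓ ^ γ := Real.rpow_le_rpow hl2.le hℓ2 hγ0.le
      have h2 : 0 < Real.log 2 ^ γ := by positivity
      calc 1 = (Real.log 2 ^ γ)⁻¹ * 1 * Real.log 2 ^ γ := by field_simp
        _ ≤ _ := by
          have := hξ1 ω
          gcongr
    constructor
    · obtain ⟨M', hM', hgM'⟩ := holderBound_of_local (A := t₂ + 1)
        (M := CB * ξ ω * √(1 + 2 * Real.log (t₂ + 1))) (β := β') hBc' (by positivity) hβ'0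
        (fun s t hs hst htA hst1 => hloc' (t₂ + 1) s t (by linarith) hs hst htA hst1)
      have hcp := controlledPath_of_equation (T := t₂) (S := t₁) hα0 hα1' hαβ hM' ht₁ hbdd hlip ha
        hbdiff.continuous hXc' hBc' hg hgM' (hint t₂ (by linarith)) heq
      have hfin := hX_bound M t₁ t₂ _ _ _ hM0 ht.le (by linarith) hcp
      have e1 : (1 + M) ^ (1 / β') ≤
          (CM + (Real.log 2 ^ γ)⁻¹) ^ (1 / β') * ξ ω ^ (1 / β) * ℓ ^ (γ / β') := by
        have h1 : 1 + M ≤ (CM + (Real.log 2 ^ γ)⁻¹) * ξ ω * ℓ ^ γ := by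
          rw [hM]
          linarith
        have h2 : ξ ω ^ (1 / β') ≤ ξ ω ^ (1 / β) :=
          Real.rpow_le_rpow_of_exponent_le (hξ1 ω) (one_div_le_one_div_of_le hβ0 hββ.le)
        calc (1 + M) ^ (1 / β') ≤ ((CM + (Real.log 2 ^ γ)⁻¹) * ξ ω * ℓ ^ γ) ^ (1 / β') := by
              gcongr
          _ = (CM + (Real.log 2 ^ γ)⁻¹) ^ (1 / β') * ξ ω ^ (1 / β') * ℓ ^ (γ / β') := by
              rw [Real.mul_rpow (by positivity) (by positivity),
                Real.mul_rpow (by positivity) hξ0.le, ← Real.rpow_mul hℓ0.le, mul_one_div]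
          _ ≤ _ := by gcongr
      have e2 : ℓ ^ (γ / β') ≤ Real.log 2 ^ (γ / β' - γ / β) * ℓ ^ (γ / β) :=
        rpow_le_const_mul_rpow hl2 hℓ2 (by gcongr)
      have e3 : (t₂ - t₁) ^ β' ≤ (t₂ - t₁) ^ β :=
        rpow_le_rpow_of_le_one (by linarith) (by linarith) hβ0.le hββ.le
      have e4 : 0 ≤ (t₂ - t₁) ^ β := Real.rpow_nonneg (by linarith) _
      have e5 : 0 ≤ (t₂ - t₁) ^ β' := Real.rpow_nonneg (by linarith) _
      calc |path X ω t₂ - path X ω t₁| ≤ CX * (1 + M) ^ (1 / β') * (t₂ - t₁) ^ β' := hfin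
        _ ≤ CX * ((CM + (Real.log 2 ^ γ)⁻¹) ^ (1 / β') * ξ ω ^ (1 / β) *
            (Real.log 2 ^ (γ / β' - γ / β) * ℓ ^ (γ / β))) * (t₂ - t₁) ^ β := by
            gcongr
            exact e1.trans (by gcongr)
        _ = (c2 - 1) * ξ ω ^ (1 / β) * (t₂ - t₁) ^ β * ℓ ^ (γ / β) := by
            rw [hc2]
            ring
        _ ≤ c2 * ξ ω ^ (1 / β) * (t₂ - t₁) ^ β * ℓ ^ (γ / β) := by
            gcongr
            linarith
        _ = _ := by rw [hκ]
    · refine ((hg.mono le_rfl (by linarith : t₂ ≤ t₂ + 1)).Lambda_le hα0 hα1' hαβ hββ.le hM0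
        (by linarith)).trans (ENNReal.ofReal_le_ofReal (max_le ?_ ?_))
      · rw [hκβ, hc1]
        refine hone.trans ?_
        gcongr
        linarith [mul_pos hCM0 hCΛ0]
      · rw [hκβ, hc1, hM, ← hCΛ]
        calc CM * ξ ω * ℓ ^ γ * CΛ = (CM * CΛ) * ξ ω * ℓ ^ γ := by ring
          _ ≤ _ := by
            gcongr
            linarith [inv_pos.2 (Real.rpow_pos_of_pos hl2 γ)]
  -- Both exponents reduce to a multiple of `ξ²`, as `(ξ^(1/β))^(2β) = ξ²`, with coefficient at most
  -- `1`.
  · refine ⟨min (1 / c1 ^ 2) (1 / c2 ^ (2 * β)), by positivity, fun x hx => ⟨?_, ?_⟩⟩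
    · have h1 : x * c1 ^ 2 ≤ 1 :=
        (le_div_iff₀ (by positivity)).1 (hx.le.trans (min_le_left _ _))
      refine (integrable_exp_mul_of_le hξm hξi h1).congr (Eventually.of_forall fun ω => ?_)
      simp only
      congr 1
      ring
    · have h1 : x * c2 ^ (2 * β) ≤ 1 :=
        (le_div_iff₀ (by positivity)).1 (hx.le.trans (min_le_right _ _))
      refine (integrable_exp_mul_of_le hξm hξi h1).congr (Eventually.of_forall fun ω => ?_)
      have hξ0 := hξpos ω
      simp only
      rw [Real.mul_rpow hc20.le (by positivity), ← Real.rpow_mul hξ0.le,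
        show 1 / β * (2 * β) = 2 by field_simp, Real.rpow_two, mul_assoc]
  · intro p hp
    -- Since `ξ ≥ 1` and `1 / β ≤ 2`, both variables are dominated by multiples of `ξ²`.
    have hm := memLp_sq_of_integrable_exp hξm hξi hp
    constructor
    · refine hm.of_le_mul (c := c1) (by fun_prop) (Eventually.of_forall fun ω => ?_)
      have hξ0 := hξpos ω
      rw [Real.norm_of_nonneg (by positivity), Real.norm_of_nonneg (by positivity)]
      gcongr
      nlinarith [hξ1 ω]
    · refine hm.of_le_mul (c := c2) ((hξm.pow_const _).const_mul _).aestronglyMeasurable (Eventually.of_forall fun ω => ?_)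
      have hξ0 := hξpos ω
      rw [Real.norm_of_nonneg (by positivity), Real.norm_of_nonneg (by positivity),
        ← Real.rpow_two]
      gcongr
      · exact hξ1 ω
      · rw [div_le_iff₀ hβ0]
        linarith

end
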